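/- Conventions. For a field $F$, let $\bar F$ be a fixed separable closure and $\mathrm{Gal}_F=\mathrm{Gal}(\bar F/F)$ with the Krull topology. A crossed module $\mathscr C=[G\xrightarrow{\partial}H]$ over $F$ consists of smooth affine algebraic groups $G,H$ over $F$, a homomorphism $\partial$ and a left action $(h,g)\mapsto h\cdot g$ of $H$ on $G$ by group automorphisms such that, as identities of morphisms of schemes (equivalently on $\bar F$-points), $$gg'g^{-1}=\partial(g)\cdot g',\qquad \partial(h\cdot g)=h\,\partial(g)\,h^{-1}.$$ A morphism $\mathscr C\to\mathscr C'=[G'\xrightarrow{\partial'}H']$ is a pair of homomorphisms $\varphi_G:G\to G'$, $\varphi_H:H\to H'$ compatible with $\partial,\partial'$ and with the actions. A $0$-cocycle is a pair $(\alpha,h)$ with $\alpha:\mathrm{Gal}_F\to G(\bar F)$ locally constant and $h\in H(\bar F)$ such that $\alpha_{st}=\alpha_s\,{}^s\alpha_t$ and $\partial(\alpha_s)\,{}^sh=h$ for all $s,t\in \mathrm{Gal}_F$. Two $0$-cocycles $(\alpha,h)$, $(\beta,h')$ are cohomologous if there is $g\in G(\bar F)$ with $h'=\partial(g)h$ and $\beta_s=g\,\alpha_s\,{}^sg^{-1}$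 for all $s$; $\mathbb H^0(F,\mathscr C)$ is the set of cohomology classes. A right $F$-torsor under $G$ is a nonempty separated $F$-scheme $P$ of finite type with a right action $*$ of $G$ such that $P\times_F G\to P\times_F P$, $(p,g)\mapsto(p,p*g)$, is an isomorphism. An $F$-bitorsor under $\mathscr C$ is a pair $(P,f)$ of such a torsor and a morphism $f:P\to H$ of $F$-schemes with $f(p*g)=f(p)\partial(g)$. A morphism $(P,f)\to(P',f')$ of bitorsors is a $G$-equivariant morphism $\psi:P\to P'$ with $f'\circ\psi=f$. Let $\mathrm{Bit}_F(\mathscr C)$ be the set of isomorphism classes. Statement. There is a family of bijections $$\Phi_{F,\mathscr C}:\mathbb H^0(F,\mathscr C)\xrightarrow{\ \sim\ }\mathrm{Bit}_F(\mathscr C),$$ for all fields $F$ and all crossed modules $\mathscr C$ over $F$, which is functorial in $\mathscr C$ and in $F$: (1) Let $\varphi:\mathscr C\to\mathscr C'$ be a morphism of crossed modules over $F$, let $x\in\mathbb H^0(F,\mathscr C)$, and let $\varphi_*x\in\mathbb H^0(F,\mathscr C')$ be its image, given on cocycles by $(\alpha,h)\mapsto(\varphi_G\circ\alpha,\varphi_H(h))$.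 A class $y\in\mathrm{Bit}_F(\mathscr C')$ is a pushforward of $\Phi_{F,\mathscr C}(x)$ along $\varphi$ if and only if $y=\Phi_{F,\mathscr C'}(\varphi_*x)$. Here $y$ is called a pushforward of a class $z\in \mathrm{Bit}_F(\mathscr C)$ if there are representatives $(P,f)$ of $z$ and $(P',f')$ of $y$ and a morphism $u:P\to P'$ with $u(p*g)=u(p)*\varphi_G(g)$ and $f'\circ u=\varphi_H\circ f$ (that is, $P'\cong P\times^GG'$ with the induced map to $H'$). In particular every class in $\mathrm{Bit}_F(\mathscr C)$ has exactly one pushforward along $\varphi$. (2) Let $E/F$ be a field extension, $\mathscr C$ a crossed module over $F$, and $\iota:\bar F\to\bar E$ an $F$-embedding of the separable closures. Then for every $x\in\mathbb H^0(F,\mathscr C)$ with $\Phi_{F,\mathscr C}(x)=[P,f]$ one has $\Phi_{E,\mathscr C_E}(x|_E)=[P_E,f_E]$, where $x|_E$ is obtained by composing $\alpha$ with the restriction homomorphism $\mathrm{Gal}_E\to\mathrm{Gal}_F$ attached to $\iota$ and mapping $G(\bar F)$ and $H(\bar F)$ to $G(\bar E)$ and $H(\bar E)$ by $\iota$. -/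

import Mathlib

universe u

namespace CrossedBitorsor

open CategoryTheory AlgebraicGeometry MonoidalCategory CartesianMonoidalCategory MonObj
open scoped Obj

noncomputable section

/-! ### Schemes over a field, base change, geometric points -/

/-- The category of schemes over a field `F`. -/
abbrev Sch (F : Type u) [Field F] := Over (Spec (.of F))

/-- The morphism `Spec E ⟶ Spec F` attached to a field extension `E/F`. -/
abbrev specMap (F E : Type u) [Field F] [Field E] [Algebra F E] :
    Spec (.of E) ⟶ Spec (.of F) :=
  Spec.map (CommRingCat.ofHom (algebraMap F E))

/-- Base change `X ↦ X_E` of schemes along a field extension `E/F`. -/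
abbrev bc (F E : Type u) [Field F] [Field E] [Algebra F E] : Sch F ⥤ Sch E :=
  Over.pullback (specMap F E)

section Pull

variable {F E : Type u} [Field F] [Field E] [Algebra F E]

/-- An `E`-scheme regarded as an `F`-scheme. -/
abbrev asF (F : Type u) {E : Type u} [Field F] [Field E] [Algebra F E] (T : Sch E) : Sch F :=
  (Over.map (specMap F E)).obj T

/-- The bijection `X(T) = X_E(T)` for an `F`-scheme `X` and an `E`-scheme `T`. -/
def pull {T : Sch E} {X : Sch F} : (asF F T ⟶ X) ≃ (T ⟶ (bc F E).obj X) :=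
  (Over.mapPullbackAdj (specMap F E)).homEquiv T X

lemma pull_eq {T : Sch E} {X : Sch F} (x : asF F T ⟶ X) :
    pull x = (Over.mapPullbackAdj (specMap F E)).unit.app T ≫ (bc F E).map x :=
  (Over.mapPullbackAdj (specMap F E)).homEquiv_unit _ _ _

lemma pull_comp {T : Sch E} {X Y : Sch F} (x : asF F T ⟶ X) (k : X ⟶ Y) :
    pull x ≫ (bc F E).map k = pull (x ≫ k) := by
  simp [pull_eq]

lemma comp_pull {T T' : Sch E} {X : Sch F} (t : T' ⟶ T) (x : asF F T ⟶ X) :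
    t ≫ pull x = pull ((Over.map (specMap F E)).map t ≫ x) :=
  ((Over.mapPullbackAdj (specMap F E)).homEquiv_naturality_left t x).symm

lemma pull_lift {T : Sch E} {X Y : Sch F} (x : asF F T ⟶ X) (y : asF F T ⟶ Y) :
    lift (pull x) (pull y) ≫ Functor.LaxMonoidal.μ (bc F E) X Y = pull (lift x y) := by
  rw [pull_eq, pull_eq, pull_eq, ← comp_lift, Category.assoc, Functor.Monoidal.lift_μ]

lemma pull_lift_comp {T : Sch E} {X Y Z : Sch F} (x : asF F T ⟶ X) (y : asF F T ⟶ Y)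
    (k : X ⊗ Y ⟶ Z) :
    lift (pull x) (pull y) ≫ Functor.LaxMonoidal.μ (bc F E) X Y ≫ (bc F E).map k =
      pull (lift x y ≫ k) := by
  rw [← Category.assoc, pull_lift, pull_comp]

lemma pull_mul {T : Sch E} {G : Sch F} [GrpObj G] (x y : asF F T ⟶ G) :
    pull (x * y) = pull x * pull y := by
  rw [pull_eq, pull_eq, pull_eq, Functor.map_mul, comp_mul]

lemma pull_one {T : Sch E} {G : Sch F} [GrpObj G] :
    pull (1 : asF F T ⟶ G) = 1 := by
  rw [pull_eq, Functor.map_one, comp_one]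

lemma pull_inv {T : Sch E} {G : Sch F} [GrpObj G] (x : asF F T ⟶ G) :
    pull x⁻¹ = (pull x)⁻¹ := by
  rw [eq_inv_iff_mul_eq_one, ← pull_mul, inv_mul_cancel, pull_one]

end Pull

/-- The absolute Galois group of `F`, for the separable closure `SeparableClosure F`. -/
abbrev AbsGal (F : Type u) [Field F] := SeparableClosure F ≃ₐ[F] SeparableClosure F

/-- The `F`-scheme `Spec F̄`, with `F̄` the separable closure of `F`; for an `F`-scheme `X`, the set
`X(F̄)` is `geomPt F ⟶ X`. -/
def geomPt (F : Type u) [Field F] : Sch F := Over.mk (specMap F (SeparableClosure F))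

/-- The automorphism of `Spec F̄` given by a Galois automorphism. -/
def galPt {F : Type u} [Field F] (s : AbsGal F) : geomPt F ⟶ geomPt F :=
  Over.homMk (Spec.map (CommRingCat.ofHom (s : SeparableClosure F →+* SeparableClosure F)))
    (by
      simp only [geomPt, Over.mk_hom, specMap, ← Spec.map_comp, ← CommRingCat.ofHom_comp]
      congr 2
      ext x
      simp)

/-- The left action `x ↦ ˢx` of the absolute Galois group on `X(F̄)`. -/
def galAct {F : Type u} [Field F] {X : Sch F} (s : AbsGal F) (x : geomPt F ⟶ X) : geomPt F ⟶ X :=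
  galPt s ≫ x

/-! ### Crossed modules -/

/-- A crossed module `[G ⟶ H]` of smooth linear (that is, affine) algebraic groups over `F`. -/
structure CrossedModule (F : Type u) [Field F] where
  G : Sch F
  H : Sch F
  [grpG : GrpObj G]
  [grpH : GrpObj H]
  [affineG : IsAffine G.left]
  [affineH : IsAffine H.left]
  [smoothG : Smooth G.hom]
  [smoothH : Smooth H.hom]
  /-- the homomorphism `∂` -/
  bd : G ⟶ H
  [isMonHom_bd : IsMonHom bd]
  /-- the left action `(h, g) ↦ h · g` of `H` on `G`, by group automorphisms -/
  act : H ⊗ G ⟶ G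
  one_act : ∀ {T : Sch F} (g : T ⟶ G), lift 1 g ≫ act = g
  mul_act : ∀ {T : Sch F} (h h' : T ⟶ H) (g : T ⟶ G),
    lift (h * h') g ≫ act = lift h (lift h' g ≫ act) ≫ act
  act_mul : ∀ {T : Sch F} (h : T ⟶ H) (g g' : T ⟶ G),
    lift h (g * g') ≫ act = (lift h g ≫ act) * (lift h g' ≫ act)
  conj_eq : ∀ {T : Sch F} (g g' : T ⟶ G), g * g' * g⁻¹ = lift (g ≫ bd) g' ≫ act
  bd_act : ∀ {T : Sch F} (h : T ⟶ H) (g : T ⟶ G),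
    (lift h g ≫ act) ≫ bd = h * (g ≫ bd) * h⁻¹

attribute [instance] CrossedModule.grpG CrossedModule.grpH CrossedModule.affineG
  CrossedModule.affineH CrossedModule.smoothG CrossedModule.smoothH CrossedModule.isMonHom_bd

/-- A morphism of crossed modules. -/
structure CrossedModule.Hom {F : Type u} [Field F] (C C' : CrossedModule F) where
  homG : C.G ⟶ C'.G
  homH : C.H ⟶ C'.H
  [isMonHom_homG : IsMonHom homG]
  [isMonHom_homH : IsMonHom homH]
  comm : homG ≫ C'.bd = C.bd ≫ homH
  act_comm : ∀ {T : Sch F} (h : T ⟶ C.H) (g : T ⟶ C.G),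
    (lift h g ≫ C.act) ≫ homG = lift (h ≫ homH) (g ≫ homG) ≫ C'.act

attribute [instance] CrossedModule.Hom.isMonHom_homG CrossedModule.Hom.isMonHom_homH

/-- The base change `C_E` of a crossed module. -/
abbrev CrossedModule.baseChange {F : Type u} [Field F] (C : CrossedModule F)
    (E : Type u) [Field E] [Algebra F E] : CrossedModule E where
  G := (bc F E).obj C.G
  H := (bc F E).obj C.H
  affineG := by dsimp; infer_instance
  affineH := by dsimp; infer_instance
  smoothG := by dsimp; infer_instance
  smoothH := by dsimp; infer_instance
  bd := (bc F E).map C.bd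
  isMonHom_bd := inferInstance
  act := Functor.LaxMonoidal.μ (bc F E) C.H C.G ≫ (bc F E).map C.act
  one_act g := by
    obtain ⟨g, rfl⟩ := pull.surjective g
    rw [← pull_one, pull_lift_comp, C.one_act]
  mul_act h h' g := by
    obtain ⟨g, rfl⟩ := pull.surjective g
    obtain ⟨h, rfl⟩ := pull.surjective h
    obtain ⟨h', rfl⟩ := pull.surjective h'
    rw [← pull_mul, pull_lift_comp, pull_lift_comp, pull_lift_comp, C.mul_act]
  act_mul h g g' := by
    obtain ⟨g, rfl⟩ := pull.surjective g
    obtain ⟨h, rfl⟩ := pull.surjective h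
    obtain ⟨g', rfl⟩ := pull.surjective g'
    rw [← pull_mul, pull_lift_comp, pull_lift_comp, pull_lift_comp, ← pull_mul, C.act_mul]
  conj_eq g g' := by
    obtain ⟨g, rfl⟩ := pull.surjective g
    obtain ⟨g', rfl⟩ := pull.surjective g'
    rw [← pull_mul, ← pull_inv, ← pull_mul, pull_comp, pull_lift_comp, C.conj_eq]
  bd_act h g := by
    obtain ⟨g, rfl⟩ := pull.surjective g
    obtain ⟨h, rfl⟩ := pull.surjective h
    rw [pull_lift_comp, pull_comp, pull_comp, ← pull_mul, ← pull_inv, ← pull_mul, C.bd_act]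

/-! ### The hypercohomology set `ℍ⁰(F, C)` -/

section H0

variable {F : Type u} [Field F]

/-- `0`-cocycles `(α, h)` with coefficients in a crossed module. -/
structure Cocycle (C : CrossedModule F) where
  α : AbsGal F → (geomPt F ⟶ C.G)
  h : geomPt F ⟶ C.H
  isLocallyConstant : IsLocallyConstant α
  cocycle : ∀ s t, α (s * t) = α s * galAct s (α t)
  bd_mul : ∀ s, (α s ≫ C.bd) * galAct s h = h

/-- Two `0`-cocycles `(α, h)` and `(β, h')` are cohomologous if there is `g ∈ G(F̄)` with
`h' = ∂(g) h` and `β_s = g α_s ˢg⁻¹` for all `s`. -/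
def Cohomologous {C : CrossedModule F} (a b : Cocycle C) : Prop :=
  ∃ g : geomPt F ⟶ C.G, b.h = (g ≫ C.bd) * a.h ∧ ∀ s, b.α s = g * a.α s * galAct s g⁻¹

lemma galAct_mul {G : Sch F} [GrpObj G] (s : AbsGal F) (x y : geomPt F ⟶ G) :
    galAct s (x * y) = galAct s x * galAct s y := comp_mul _ _ _

lemma galAct_one {G : Sch F} [GrpObj G] (s : AbsGal F) :
    galAct s (1 : geomPt F ⟶ G) = 1 := comp_one _

/-- The equivalence relation "cohomologous" on `0`-cocycles. -/
def cocycleSetoid (C : CrossedModule F) : Setoid (Cocycle C) where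
  r := Cohomologous
  iseqv :=
    { refl := fun a => ⟨1, by simp [one_comp], fun s => by simp [galAct_one]⟩
      symm := by
        rintro a b ⟨g, h1, h2⟩
        refine ⟨g⁻¹, by rw [h1, GrpObj.inv_comp, inv_mul_cancel_left], fun s => ?_⟩
        rw [h2, inv_inv]
        simp only [_root_.mul_assoc, ← galAct_mul, inv_mul_cancel, galAct_one, _root_.mul_one,
          inv_mul_cancel_left]
      trans := by
        rintro a b c ⟨g, h1, h2⟩ ⟨g', h1', h2'⟩
        refine ⟨g' * g, by rw [h1', h1, mul_comp, _root_.mul_assoc], fun s => ?_⟩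
        rw [h2', h2, mul_inv_rev, galAct_mul]
        simp only [_root_.mul_assoc] }

/-- `ℍ⁰(F, C)`: classes of `0`-cocycles. -/
def H0 (C : CrossedModule F) : Type u := Quotient (cocycleSetoid C)

/-- The image of a `0`-cocycle under a morphism of crossed modules. -/
def Cocycle.map {C C' : CrossedModule F} (φ : C.Hom C') (a : Cocycle C) : Cocycle C' where
  α s := a.α s ≫ φ.homG
  h := a.h ≫ φ.homH
  isLocallyConstant := a.isLocallyConstant.comp (· ≫ φ.homG)
  cocycle s t := by
    rw [a.cocycle, mul_comp]
    simp [galAct]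
  bd_mul s := by
    conv_rhs => rw [← a.bd_mul s]
    rw [mul_comp]
    simp [galAct, φ.comm]

/-- The map `ℍ⁰(F, C) → ℍ⁰(F, C')` induced by a morphism `C ⟶ C'`. -/
def H0.map {C C' : CrossedModule F} (φ : C.Hom C') : H0 C → H0 C' :=
  Quotient.map (sa := cocycleSetoid C) (sb := cocycleSetoid C') (Cocycle.map φ) <| by
    rintro a b ⟨g, h1, h2⟩
    refine ⟨g ≫ φ.homG, ?_, fun s => ?_⟩
    · simp [Cocycle.map, h1, mul_comp, φ.comm]
    · simp [Cocycle.map, h2, mul_comp, galAct, GrpObj.inv_comp]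

end H0

/-! ### Restriction along field extensions -/

section Restriction

variable {F E : Type u} [Field F] [Field E] [Algebra F E]
variable (j : SeparableClosure F →ₐ[F] SeparableClosure E)

/-- Given an embedding `j : F̄ → Ē` of separable closures over `F → E`, the restriction
homomorphism `Gal_E → Gal_F`, characterised by `j (resGal j s x) = s (j x)`. -/
def resGal : AbsGal E →* AbsGal F :=
  letI := j.toRingHom.toAlgebra
  haveI : IsScalarTower F (SeparableClosure F) (SeparableClosure E) :=
    IsScalarTower.of_algebraMap_eq fun x => (j.commutes x).symm
  (AlgEquiv.restrictNormalHom (F := F) (K₁ := SeparableClosure E) (SeparableClosure F)).comp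
    (AlgEquiv.restrictScalarsHom F)

lemma resGal_spec (s : AbsGal E) (x : SeparableClosure F) : j (resGal j s x) = s (j x) := by
  let := j.toRingHom.toAlgebra
  have : IsScalarTower F (SeparableClosure F) (SeparableClosure E) :=
    IsScalarTower.of_algebraMap_eq fun x => (j.commutes x).symm
  exact AlgEquiv.restrictNormal_commutes (s.restrictScalars F) (SeparableClosure F) x

lemma continuous_resGal : Continuous (resGal j) := by
  apply continuous_of_continuousAt_one
  intro A hA
  rw [map_one, krullTopology_mem_nhds_one_iff] at hA
  obtain ⟨L, hL, hLA⟩ := hA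
  rw [Filter.mem_map, krullTopology_mem_nhds_one_iff]
  obtain ⟨S, hS⟩ := (Submodule.fg_top (Subalgebra.toSubmodule L.toSubalgebra)).mp
    (Module.finite_def.mp hL)
  have hfin : Finite (j '' (S : Set (SeparableClosure F))) := (S.finite_toSet.image j).to_subtype
  refine ⟨IntermediateField.adjoin E (j '' S),
    IntermediateField.finiteDimensional_adjoin
      fun x _ => Algebra.IsIntegral.isIntegral x, fun s hs => hLA ?_⟩
  have hs' := (IntermediateField.mem_fixingSubgroup_iff _ _).mp hs
  refine (IntermediateField.mem_fixingSubgroup_iff _ _).mpr fun x hx => ?_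
  have hx' : x ∈ Submodule.span F (S : Set (SeparableClosure F)) := by rw [hS]; exact hx
  have key : Set.EqOn (resGal j s).toLinearMap (LinearMap.id (R := F)) S := fun y hy =>
    j.injective ((resGal_spec j s y).trans
      (hs' _ (IntermediateField.subset_adjoin E _ ⟨y, hy, rfl⟩)))
  exact LinearMap.eqOn_span key hx'

/-- The morphism `Spec Ē ⟶ Spec F̄` of `F`-schemes given by `j`. -/
def ptMap : asF F (geomPt E) ⟶ geomPt F :=
  Over.homMk (Spec.map (CommRingCat.ofHom (j : SeparableClosure F →+* SeparableClosure E)))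
    (by
      simp only [geomPt, Over.mk_hom, Over.map_obj_hom, specMap, ← Spec.map_comp,
        ← CommRingCat.ofHom_comp]
      congr 2
      ext x
      simp [← IsScalarTower.algebraMap_apply])

/-- The map `X(F̄) → X(Ē) = X_E(Ē)` induced by `j`. -/
def resPt {X : Sch F} (x : geomPt F ⟶ X) : geomPt E ⟶ (bc F E).obj X := pull (ptMap j ≫ x)

lemma resPt_comp {X Y : Sch F} (x : geomPt F ⟶ X) (k : X ⟶ Y) :
    resPt j x ≫ (bc F E).map k = resPt j (x ≫ k) := by
  simp [resPt, pull_comp]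

lemma resPt_mul {G : Sch F} [GrpObj G] (x y : geomPt F ⟶ G) :
    resPt j (x * y) = resPt j x * resPt j y := by
  rw [resPt, comp_mul, pull_mul]; rfl

lemma resPt_inv {G : Sch F} [GrpObj G] (x : geomPt F ⟶ G) :
    resPt j x⁻¹ = (resPt j x)⁻¹ := by
  rw [resPt, GrpObj.comp_inv, pull_inv]; rfl

lemma galAct_resPt {X : Sch F} (s : AbsGal E) (x : geomPt F ⟶ X) :
    galAct s (resPt j x) = resPt j (galAct (resGal j s) x) := by
  rw [galAct, resPt, comp_pull, resPt, galAct, ← Category.assoc, ← Category.assoc]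
  congr 2
  apply Over.OverMorphism.ext
  refine (Spec.map_comp _ _).symm.trans (Eq.trans ?_ (Spec.map_comp _ _))
  congr 1
  ext x
  exact congrArg _ (resGal_spec j s x).symm

/-- The restriction of a `0`-cocycle along a field extension, with respect to `j`. -/
def Cocycle.res {C : CrossedModule F} (a : Cocycle C) : Cocycle (C.baseChange E) where
  α s := resPt j (a.α (resGal j s))
  h := resPt j a.h
  isLocallyConstant :=
    (a.isLocallyConstant.comp_continuous (continuous_resGal j)).comp (resPt j)
  cocycle s t := by
    rw [map_mul, a.cocycle, galAct_resPt]
    exact resPt_mul j _ _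
  bd_mul s := by
    conv_rhs => rw [← a.bd_mul (resGal j s)]
    rw [galAct_resPt]
    exact (congrArg (· * _) (resPt_comp j _ C.bd)).trans (resPt_mul j _ _).symm

/-- The restriction map `ℍ⁰(F, C) → ℍ⁰(E, C_E)`, computed with respect to `j`. -/
def H0.res {C : CrossedModule F} : H0 C → H0 (C.baseChange E) :=
  Quotient.map (sa := cocycleSetoid C) (sb := cocycleSetoid (C.baseChange E)) (Cocycle.res j) <| by
    rintro a b ⟨g, h1, h2⟩
    refine ⟨resPt j g, ?_, fun s => ?_⟩
    · refine (congrArg (resPt j) h1).trans ((resPt_mul j _ _).trans ?_)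
      exact (congrArg (· * _) (resPt_comp j g C.bd)).symm
    · refine (congrArg (resPt j) (h2 _)).trans ?_
      rw [resPt_mul, resPt_mul, ← galAct_resPt, resPt_inv]
      rfl

end Restriction

/-! ### Bitorsors -/

/-- An `F`-bitorsor `(P, f)` under a crossed module `C = [G ⟶ H]`: a right `F`-torsor `P` under `G`
(a nonempty variety, on which `G` acts simply transitively in the sense of schemes, that is,
`P × G ⟶ P × P`, `(p, g) ↦ (p, p * g)` is bijective on `T`-points for every `F`-scheme `T`),
together with a morphism `f : P ⟶ H` such that `f(p * g) = f(p) ∂(g)`. -/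
structure Bitorsor {F : Type u} [Field F] (C : CrossedModule F) where
  P : Sch F
  [nonempty : Nonempty P.left]
  [locallyOfFiniteType : LocallyOfFiniteType P.hom]
  [quasiCompact : QuasiCompact P.hom]
  [isSeparated : IsSeparated P.hom]
  /-- the right action `(p, g) ↦ p * g` of `G` on `P` -/
  act : P ⊗ C.G ⟶ P
  act_one : ∀ {T : Sch F} (p : T ⟶ P), lift p 1 ≫ act = p
  act_mul : ∀ {T : Sch F} (p : T ⟶ P) (g g' : T ⟶ C.G),
    lift p (g * g') ≫ act = lift (lift p g ≫ act) g' ≫ act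
  simply_transitive : ∀ {T : Sch F} (p q : T ⟶ P), ∃! g : T ⟶ C.G, lift p g ≫ act = q
  /-- the morphism `f : P ⟶ H` -/
  f : P ⟶ C.H
  f_act : ∀ {T : Sch F} (p : T ⟶ P) (g : T ⟶ C.G),
    (lift p g ≫ act) ≫ f = (p ≫ f) * (g ≫ C.bd)

attribute [instance] Bitorsor.nonempty Bitorsor.locallyOfFiniteType Bitorsor.quasiCompact
  Bitorsor.isSeparated

section Bitorsor

variable {F : Type u} [Field F]

/-- For a morphism of crossed modules `φ : C ⟶ C'`, a `φ`-equivariant morphism from a bitorsor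
`(P, f)` under `C` to a bitorsor `(P', f')` under `C'`: a morphism `u : P ⟶ P'` such that
`u(p * g) = u(p) * φ(g)` and `f' ∘ u = φ ∘ f`. -/
structure EquivariantHom {C C' : CrossedModule F} (φ : C.Hom C') (X : Bitorsor C)
    (Y : Bitorsor C') where
  hom : X.P ⟶ Y.P
  equivariant : ∀ {T : Sch F} (p : T ⟶ X.P) (g : T ⟶ C.G),
    (lift p g ≫ X.act) ≫ hom = lift (p ≫ hom) (g ≫ φ.homG) ≫ Y.act
  comp_f : hom ≫ Y.f = X.f ≫ φ.homH

/-- Morphisms of bitorsors under `C`: `G`-equivariant morphisms `φ` with `f' ∘ φ = f`. -/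
@[ext]
structure Bitorsor.Hom {C : CrossedModule F} (X Y : Bitorsor C) where
  hom : X.P ⟶ Y.P
  equivariant : ∀ {T : Sch F} (p : T ⟶ X.P) (g : T ⟶ C.G),
    (lift p g ≫ X.act) ≫ hom = lift (p ≫ hom) g ≫ Y.act
  comp_f : hom ≫ Y.f = X.f

/-- The category of `F`-bitorsors under `C`. -/
instance (C : CrossedModule F) : Category (Bitorsor C) where
  Hom := Bitorsor.Hom
  id X := ⟨𝟙 _, by simp, by simp⟩
  comp u v := ⟨u.hom ≫ v.hom, fun p g => by
    rw [← Category.assoc, u.equivariant, v.equivariant, Category.assoc],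
    by rw [Category.assoc, v.comp_f, u.comp_f]⟩
  id_comp _ := Bitorsor.Hom.ext (Category.id_comp _)
  comp_id _ := Bitorsor.Hom.ext (Category.comp_id _)
  assoc _ _ _ := Bitorsor.Hom.ext (Category.assoc _ _ _)

/-- `Bit_F(C)`: isomorphism classes of `F`-bitorsors under `C`. -/
def Bit (C : CrossedModule F) : Type (u + 1) := Quotient (isIsomorphicSetoid (Bitorsor C))

/-- The isomorphism class `[P, f]`. -/
def Bitorsor.cls {C : CrossedModule F} (X : Bitorsor C) : Bit C :=
  Quotient.mk (isIsomorphicSetoid (Bitorsor C)) X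

/-- `y ∈ Bit_F(C')` is the pushforward of `x ∈ Bit_F(C)` along `φ : C ⟶ C'`, that is, the class
obtained by extension of the structure group `P' = P ×^G G'` with `f'[p, g'] = φ(f(p)) ∂'(g')`.
Since `P'` is a torsor under `G'`, this means that there is a `φ`-equivariant morphism from a
representative of `x` to a representative of `y`. -/
def IsPushforward {C C' : CrossedModule F} (φ : C.Hom C') (x : Bit C) (y : Bit C') : Prop :=
  ∃ (X : Bitorsor C) (Y : Bitorsor C'), X.cls = x ∧ Y.cls = y ∧ Nonempty (EquivariantHom φ X Y)

variable (E : Type u) [Field E] [Algebra F E]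

/-- The base change `(P_E, f_E)` of a bitorsor. -/
abbrev Bitorsor.baseChange {C : CrossedModule F} (X : Bitorsor C) : Bitorsor (C.baseChange E) where
  P := (bc F E).obj X.P
  nonempty := by
    have : Surjective (specMap F E) := inferInstance
    obtain ⟨y⟩ := X.nonempty
    obtain ⟨z, -⟩ := (Limits.pullback.fst X.P.hom (specMap F E)).surjective y
    exact ⟨z⟩
  locallyOfFiniteType := by dsimp; infer_instance
  quasiCompact := by dsimp; infer_instance
  isSeparated := by dsimp; infer_instance
  act := Functor.LaxMonoidal.μ (bc F E) X.P C.G ≫ (bc F E).map X.act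
  act_one p := by
    obtain ⟨p, rfl⟩ := pull.surjective p
    refine (congrArg (fun z => lift (pull p) z ≫ _) (pull_one (G := C.G)).symm).trans ?_
    rw [pull_lift_comp, X.act_one]
  act_mul p g g' := by
    obtain ⟨p, rfl⟩ := pull.surjective p
    obtain ⟨g, rfl⟩ := (pull (X := C.G)).surjective g
    obtain ⟨g', rfl⟩ := (pull (X := C.G)).surjective g'
    refine (congrArg (fun z => lift (pull p) z ≫ _) (pull_mul (G := C.G) g g').symm).trans ?_
    rw [pull_lift_comp, pull_lift_comp, pull_lift_comp, X.act_mul]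
  simply_transitive p q := by
    obtain ⟨p, rfl⟩ := pull.surjective p
    obtain ⟨q, rfl⟩ := pull.surjective q
    obtain ⟨g, hg, huniq⟩ := X.simply_transitive p q
    refine ⟨pull g, ?_, fun g' hg' => ?_⟩
    · beta_reduce
      rw [pull_lift_comp, hg]
    · obtain ⟨g', rfl⟩ := (pull (X := C.G)).surjective g'
      rw [pull_lift_comp] at hg'
      rw [huniq g' (pull.injective hg')]
  f := (bc F E).map X.f
  f_act p g := by
    obtain ⟨p, rfl⟩ := pull.surjective p
    obtain ⟨g, rfl⟩ := (pull (X := C.G)).surjective g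
    rw [pull_lift_comp, pull_comp, X.f_act, pull_mul, pull_comp]
    exact congrArg (_ * ·) (pull_comp g C.bd).symm

/-- Base change of bitorsors as a functor. -/
def Bitorsor.baseChangeFunctor (C : CrossedModule F) :
    Bitorsor C ⥤ Bitorsor (C.baseChange E) where
  obj X := X.baseChange E
  map {X Y} u := ⟨(bc F E).map u.hom, fun p g => by
      obtain ⟨p, rfl⟩ := (pull (X := X.P)).surjective p
      obtain ⟨g, rfl⟩ := (pull (X := C.G)).surjective g
      refine (congrArg (· ≫ _) (pull_lift_comp p g X.act)).trans ?_
      rw [pull_comp, pull_comp, u.equivariant]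
      exact (pull_lift_comp _ g Y.act).symm,
    by
      refine ((bc F E).map_comp u.hom Y.f).symm.trans ?_
      rw [u.comp_f]⟩
  map_id X := Bitorsor.Hom.ext ((bc F E).map_id X.P)
  map_comp u v := Bitorsor.Hom.ext ((bc F E).map_comp u.hom v.hom)

/-- The map `Bit_F(C) → Bit_E(C_E)`, `[P, f] ↦ [P_E, f_E]`. -/
def Bit.baseChange {C : CrossedModule F} : Bit C → Bit (C.baseChange E) :=
  Quotient.map (sa := isIsomorphicSetoid (Bitorsor C))
    (sb := isIsomorphicSetoid (Bitorsor (C.baseChange E))) (Bitorsor.baseChange E) <| by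
    rintro X Y ⟨e⟩
    exact ⟨(Bitorsor.baseChangeFunctor E C).mapIso e⟩

end Bitorsor

end

end CrossedBitorsor

/-!
# Bitorsors under a crossed module and hypercohomology in degree zero

Let `(P, f)` be a bitorsor under `[G → H]` over `F`. Since `G` is smooth and affine, `P` is smooth
and affine too (descent along `P → Spec F`, respectively along `F̄/F`), so it has a point `p` over
the separable closure `F̄`. There are unique `α_s ∈ G(F̄)` with `ˢp = p * α_s`, and with
`h = f(p)⁻¹` the pair `(α, h)` is a `0`-cocycle: `α` is a cocycle because the Galois group acts,
it is locally constant because `p` is defined over a finite extension, and `∂(α_s) ˢh = h` is the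
relation `f(ˢp) = f(p) ∂(α_s)`. The predicate `IsCocycleAt X p a` records this situation, and all
parts of the theorem are statements about it.

* Replacing `p` by `p * g⁻¹` runs through the cocycles cohomologous to `(α, h)`
  (`IsCocycleAt.cohomologous`, `IsCocycleAt.of_cohomologous`).
* Every cocycle occurs (`exists_bitorsor`). The formula `(g, κ) ↦ (α_s(κ)⁻¹ g, s κ)` is a semilinear
  Galois action on `G ×_F F̄` by automorphisms commuting with right translations. Galois descent
  (`exists_form`) gives an affine `F`-scheme `P` which becomes `G` over `F̄`; right translations,
  the difference `P × P → G` and the map `g ↦ h⁻¹ ∂(g)` commute with the action, so they descend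
  to `F` by `exists_fst_comp_eq`.
* If `X` has cocycle `a` at `p` and `Y` has cocycle `φ(a)` at `q`, then `p * g ↦ q * φ(g)` is Galois
  equivariant and descends to a `φ`-equivariant morphism `X → Y`
  (`IsCocycleAt.exists_equivariantHom`); conversely such a morphism maps cocycles to cocycles
  (`IsCocycleAt.map`). For `φ = id` this shows that the cocycle class determines the bitorsor, and
  for general `φ` it is the functoriality in the crossed module.
* The cocycle of a base change is the restricted cocycle (`IsCocycleAt.res`).

Galois descent for vector spaces (`GaloisDescent.isBaseChange_invariants`), applied to the ring of
functions of an affine `F̄`-scheme, underlies the descent of schemes; for morphisms into an affine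
scheme, it is enough that the Galois invariants of `R ⊗_F F̄` are `R`
(`GaloisDescent.exists_tmul_one_of_invariant`).
-/

/-! ### Galois descent for vector spaces -/

namespace GaloisDescent

open scoped Topology TensorProduct

variable {F K M : Type*} [Field F] [Field K] [Algebra F K] [AddCommGroup M] [Module K M]
  [Module F M] [IsScalarTower F K M]

/-- An action of `Gal(K/F)` on a `K`-vector space is semilinear when `s(c m) = s(c) s(m)`. -/
def IsSemilinear (ρ : Gal(K/F) →* AddMonoid.End M) : Prop :=
  ∀ (s : Gal(K/F)) (c : K) (m : M), ρ s (c • m) = s c • ρ s m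

/-- The `F`-subspace of vectors fixed by a semilinear action. -/
def invariants (ρ : Gal(K/F) →* AddMonoid.End M) (hρ : IsSemilinear ρ) : Submodule F M where
  carrier := {m | ∀ s, ρ s m = m}
  add_mem' ha hb s := by rw [map_add, ha s, hb s]
  zero_mem' s := map_zero _
  smul_mem' c m hm s := by
    rw [← algebraMap_smul K c m, hρ, hm s, AlgEquiv.commutes]

lemma mem_invariants (ρ : Gal(K/F) →* AddMonoid.End M) (hρ : IsSemilinear ρ) {m : M} :
    m ∈ invariants ρ hρ ↔ ∀ s, ρ s m = m := Iff.rfl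

/-- Invariant vectors that are independent over `F` are independent over `K`: in a shortest relation
with one coefficient equal to `1`, applying `s` and subtracting shows that all coefficients are
Galois invariant. -/
lemma coeff_eq_zero_of_invariant [IsGalois F K] {ι : Type*} (ρ : Gal(K/F) →* AddMonoid.End M)
    (hρ : IsSemilinear ρ) (b : ι → M) (hb : ∀ i s, ρ s (b i) = b i)
    (hli : LinearIndependent F b) (S : Finset ι) :
    ∀ c : ι → K, ∑ i ∈ S, c i • b i = 0 → ∀ i ∈ S, c i = 0 := by
  classical
  induction S using Finset.induction_on with
  | empty => simp
  | insert j S hj ih =>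
    intro c hc
    have key : c j = 0 := by
      by_contra hcj
      set d : ι → K := fun i => (c j)⁻¹ * c i with hd
      have hdj : d j = 1 := inv_mul_cancel₀ hcj
      have hsum : ∑ i ∈ insert j S, d i • b i = 0 := by
        simp only [hd, mul_smul, ← Finset.smul_sum, hc, smul_zero]
      have hfix : ∀ i ∈ insert j S, ∀ s : Gal(K/F), s (d i) = d i := by
        intro i hi s
        have h2 : ∑ i ∈ insert j S, s (d i) • b i = 0 := by
          have := congrArg (ρ s) hsum
          rw [map_sum, map_zero] at this
          simpa only [hρ s, hb] using this
        rcases Finset.mem_insert.mp hi with rfl | hi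
        · rw [hdj, map_one]
        · refine sub_eq_zero.mp (ih (fun i => s (d i) - d i) ?_ i hi)
          have h3 := sub_eq_zero.mpr (h2.trans hsum.symm)
          rw [← Finset.sum_sub_distrib, Finset.sum_insert hj, hdj, map_one, sub_self, zero_add]
            at h3
          simpa only [sub_smul] using h3
      have hF : ∀ i, ∃ x : F, i ∈ insert j S → algebraMap F K x = d i := fun i => by
        by_cases hi : i ∈ insert j S
        · obtain ⟨x, hx⟩ := (InfiniteGalois.mem_range_algebraMap_iff_fixed (k := F) (d i)).mpr
            (hfix i hi)
          exact ⟨x, fun _ => hx⟩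
        · exact ⟨0, fun h => absurd h hi⟩
      choose x hx using hF
      have h4 : ∑ i ∈ insert j S, x i • b i = 0 := by
        rw [← hsum]
        refine Finset.sum_congr rfl fun i hi => ?_
        rw [← hx i hi, algebraMap_smul]
      have h5 := linearIndependent_iff'.mp hli _ _ h4 j (Finset.mem_insert_self _ _)
      have h6 := hx j (Finset.mem_insert_self _ _)
      rw [h5, map_zero, hdj] at h6
      exact zero_ne_one h6
    rw [Finset.sum_insert hj, key, zero_smul, zero_add] at hc
    intro i hi
    rcases Finset.mem_insert.mp hi with rfl | hi
    · exact key
    · exact ih c hc i hi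

/-- By Dedekind's independence of characters, the vectors `(φ(e))_φ`, for `e` in `L` and `φ` running
over the embeddings of `L`, span the whole coordinate space. -/
lemma span_range_embeddings_eq_top (L : Type*) [Field L] [Algebra F L] [FiniteDimensional F L] :
    Submodule.span K (Set.range fun (e : L) (φ : L →ₐ[F] K) => φ e) = ⊤ := by
  classical
  by_contra hne
  obtain ⟨f, hf0, hf⟩ := Submodule.exists_le_ker_of_lt_top _ (lt_top_iff_ne_top.mpr hne)
  apply hf0
  have hsum : ∀ v : (L →ₐ[F] K) → K, f v = ∑ φ, v φ * f (Pi.single φ 1) := fun v => by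
    conv_lhs => rw [pi_eq_sum_univ' v, map_sum]
    refine Finset.sum_congr rfl fun φ _ => ?_
    rw [map_smul, smul_eq_mul]
  have h0 : ∑ φ : L →ₐ[F] K, f (Pi.single φ 1) • φ.toLinearMap = 0 := by
    ext e
    have := hf (Submodule.subset_span ⟨e, rfl⟩)
    rw [LinearMap.mem_ker, hsum] at this
    simpa [LinearMap.sum_apply, mul_comm] using this
  have h1 := Fintype.linearIndependent_iff.mp (linearIndependent_toLinearMap F L K) _ h0
  ext φ
  simpa using h1 φ

/-- A vector with open stabiliser is a `K`-linear combination of the traces `∑_φ φ̃(e m)`, where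
`e` lies in a finite extension `L` whose fixing subgroup stabilises `m`, and `φ̃` extends the
embedding `φ` of `L`. -/
lemma mem_span_invariants [IsGalois F K] (ρ : Gal(K/F) →* AddMonoid.End M) (hρ : IsSemilinear ρ)
    (m : M) (hm : {s | ρ s m = m} ∈ 𝓝 (1 : Gal(K/F))) :
    m ∈ Submodule.span K (invariants ρ hρ : Set M) := by
  classical
  obtain ⟨L, hL, hLm⟩ := (krullTopology_mem_nhds_one_iff F K _).mp hm
  have hlift : ∀ φ : L →ₐ[F] K, ∃ s : Gal(K/F), ∀ x : L, s x = φ x := fun φ => by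
    exact ⟨AlgEquiv.ofBijective (φ.liftNormal K) (AlgHom.normal_bijective F K K _),
      fun x => φ.liftNormal_commutes K x⟩
  choose t ht using hlift
  have hmul : ∀ (s s' : Gal(K/F)) (x : M), ρ s (ρ s' x) = ρ (s * s') x := fun s s' x => by
    rw [map_mul]; rfl
  -- the value on `e • m` depends only on the restriction to `L`
  have hdep : ∀ (s s' : Gal(K/F)), (∀ x : L, s x = s' x) → ∀ e : L,
      ρ s ((e : K) • m) = ρ s' ((e : K) • m) := by
    intro s s' h e
    have h1 : ρ (s'⁻¹ * s) m = m := hLm <| (IntermediateField.mem_fixingSubgroup_iff _ _).mpr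
      fun x hx => by
        rw [AlgEquiv.mul_apply, h ⟨x, hx⟩, ← AlgEquiv.mul_apply, inv_mul_cancel,
          AlgEquiv.one_apply]
    have h2 : ρ s m = ρ s' m := by
      conv_rhs => rw [← h1]
      rw [hmul, mul_inv_cancel_left]
    rw [hρ, hρ, h e, h2]
  let w : L → M := fun e => ∑ φ : L →ₐ[F] K, ρ (t φ) ((e : K) • m)
  have hw : ∀ e, w e ∈ invariants ρ hρ := by
    intro e s
    simp only [w, map_sum]
    let σ : (L →ₐ[F] K) ≃ (L →ₐ[F] K) := AlgEquiv.arrowCongr AlgEquiv.refl s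
    refine Fintype.sum_equiv σ _ _ fun φ => ?_
    rw [hmul]
    refine hdep _ _ (fun x => ?_) e
    rw [AlgEquiv.mul_apply, ht, ht]
    rfl
  have hcomb : ∀ v ∈ Submodule.span K (Set.range fun (e : L) (φ : L →ₐ[F] K) => φ e),
      ∑ φ : L →ₐ[F] K, v φ • ρ (t φ) m ∈ Submodule.span K (invariants ρ hρ : Set M) := by
    intro v hv
    induction hv using Submodule.span_induction with
    | mem v hv =>
      obtain ⟨e, rfl⟩ := hv
      refine Submodule.subset_span ?_
      convert! hw e using 1
      refine Finset.sum_congr rfl fun φ _ => ?_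
      rw [hρ, ht]
    | zero => simp
    | add v v' _ _ h h' =>
      simp only [Pi.add_apply, add_smul, Finset.sum_add_distrib]
      exact add_mem h h'
    | smul c v _ h =>
      simp only [Pi.smul_apply, smul_eq_mul, mul_smul, ← Finset.smul_sum]
      exact Submodule.smul_mem _ c h
  have := hcomb (Pi.single L.val 1) (by rw [span_range_embeddings_eq_top L]; trivial)
  rw [Finset.sum_eq_single L.val (fun φ _ h => by rw [Pi.single_eq_of_ne h, zero_smul])
    (fun h => absurd (Finset.mem_univ _) h), Pi.single_eq_same, one_smul] at this
  have h1 := hdep (t L.val) 1 (fun x => by rw [ht]; rfl) 1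
  simp only [OneMemClass.coe_one, one_smul, map_one, AddMonoid.End.one_apply] at h1
  rwa [h1] at this

/-- Galois descent: `M = K ⊗ M^Γ` for a semilinear action with open stabilisers. -/
theorem isBaseChange_invariants [IsGalois F K] (ρ : Gal(K/F) →* AddMonoid.End M)
    (hρ : IsSemilinear ρ) (hm : ∀ m, {s | ρ s m = m} ∈ 𝓝 (1 : Gal(K/F))) :
    IsBaseChange K (invariants ρ hρ).subtype := by
  let b := Module.Basis.ofVectorSpace F (invariants ρ hρ)
  have hliF : LinearIndependent F fun i => ((b i : invariants ρ hρ) : M) :=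
    b.linearIndependent.map' (invariants ρ hρ).subtype (Submodule.ker_subtype _)
  have hli : LinearIndependent K fun i => ((b i : invariants ρ hρ) : M) :=
    linearIndependent_iff'.mpr fun S c hc => coeff_eq_zero_of_invariant ρ hρ _
      (fun i => (mem_invariants ρ hρ).mp (b i).2) hliF S c hc
  have hsp : ⊤ ≤ Submodule.span K (Set.range fun i => ((b i : invariants ρ hρ) : M)) := by
    intro m _
    refine Submodule.span_le.mpr (fun x hx => ?_) (mem_span_invariants ρ hρ m (hm m))
    have h1 : (⟨x, hx⟩ : invariants ρ hρ) ∈ Submodule.span F (Set.range b) := by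
      rw [b.span_eq]; trivial
    have h2 := Submodule.mem_map_of_mem (f := (invariants ρ hρ).subtype) h1
    rw [Submodule.map_span, ← Set.range_comp] at h2
    exact Submodule.span_le_restrictScalars F K _ h2
  let b' := Module.Basis.mk hli hsp
  refine IsBaseChange.of_equiv ((b.baseChange K).equiv b' (Equiv.refl _)) fun x => ?_
  have : (((b.baseChange K).equiv b' (Equiv.refl _)).toLinearMap.restrictScalars F) ∘ₗ
      (TensorProduct.mk F K (invariants ρ hρ) 1) = (invariants ρ hρ).subtype := by
    refine b.ext fun i => ?_
    have h1 : (1 : K) ⊗ₜ[F] b i = b.baseChange K i := by simp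
    simp only [LinearMap.comp_apply, TensorProduct.mk_apply, LinearMap.restrictScalars_apply, h1]
    refine ((b.baseChange K).equiv_apply i b' (Equiv.refl _)).trans ?_
    exact Module.Basis.mk_apply hli hsp i
  exact DFunLike.congr_fun this x

/-- The Galois invariants of `R ⊗ K` are the elements of `R`. -/
lemma exists_tmul_one_of_invariant [IsGalois F K] {R : Type*} [AddCommGroup R] [Module F R]
    (z : R ⊗[F] K) (hz : ∀ s : Gal(K/F), TensorProduct.map LinearMap.id s.toLinearMap z = z) :
    ∃ r : R, r ⊗ₜ 1 = z := by
  classical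
  let b := Module.Basis.ofVectorSpace F R
  let e := TensorProduct.equivFinsuppOfBasisLeft (N := K) b
  have he : ∀ (s : Gal(K/F)) z i, e (TensorProduct.map LinearMap.id s.toLinearMap z) i =
      s (e z i) := by
    intro s z i
    induction z using TensorProduct.induction_on with
    | zero => simp
    | tmul r c => simp [e]
    | add x y hx hy => simp only [map_add, Finsupp.add_apply, hx, hy]
  have hfix : ∀ i, ∃ x : F, algebraMap F K x = e z i := fun i =>
    (InfiniteGalois.mem_range_algebraMap_iff_fixed (k := F) (e z i)).mpr fun s => by
      rw [← he, hz]
  choose x hx using hfix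
  refine ⟨∑ i ∈ (e z).support, x i • b i, e.injective (Finsupp.ext fun i => ?_)⟩
  rw [TensorProduct.sum_tmul, map_sum, Finsupp.finsetSum_apply]
  by_cases hi : i ∈ (e z).support
  · rw [Finset.sum_eq_single i]
    · simp [e, ← hx, Algebra.algebraMap_eq_smul_one]
    · intro j _ hj
      simp [e, Ne.symm hj]
    · exact fun h => absurd hi h
  · rw [Finset.sum_eq_zero, Finsupp.notMem_support_iff.mp hi]
    intro j hj
    have : i ≠ j := fun h => hi (h ▸ hj)
    simp [e, this]

end GaloisDescent

namespace CrossedBitorsor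

open CategoryTheory AlgebraicGeometry MonoidalCategory CartesianMonoidalCategory MonObj
open scoped Obj Topology TensorProduct

noncomputable section

/-! ### Functions on `T ×_F F̄` -/

section Functions

variable {F : Type u} [Field F]

lemma isPullback_fst_snd (T S : Sch F) :
    IsPullback (fst T S).left (snd T S).left T.hom S.hom :=
  IsPullback.of_hasPullback _ _

instance : IsAffine (geomPt F).left := inferInstanceAs (IsAffine (Spec _))

instance (T : Sch F) [IsAffine T.left] : IsAffineHom T.hom :=
  isAffineHom_of_isAffine _

instance (T S : Sch F) [IsAffine T.left] [IsAffine S.left] : IsAffine (T ⊗ S).left := by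
  dsimp; infer_instance

instance surjective_geomPt : Surjective (geomPt F).hom :=
  inferInstanceAs (Surjective (specMap F (SeparableClosure F)))

instance flat_geomPt : Flat (geomPt F).hom :=
  inferInstanceAs (Flat (specMap F (SeparableClosure F)))

instance surjective_fst (T : Sch F) : Surjective (fst T (geomPt F)).left := by
  dsimp; infer_instance

instance flat_fst (T : Sch F) : Flat (fst T (geomPt F)).left := by
  dsimp; infer_instance

instance quasiCompact_fst (T : Sch F) : QuasiCompact (fst T (geomPt F)).left := by
  dsimp; infer_instance

instance epi_fst_left (T : Sch F) : Epi (fst T (geomPt F)).left :=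
  Flat.epi_of_flat_of_surjective _

instance epi_fst (T : Sch F) : Epi (fst T (geomPt F)) :=
  (Over.forget _).epi_of_epi_map (epi_fst_left T)

/-- Flat base change: `Γ(T ×_F F̄) = Γ(T) ⊗_F F̄` for `T` quasi-compact and quasi-separated. -/
lemma isPushout_appTop (T : Sch F) [CompactSpace T.left] [QuasiSeparatedSpace T.left] :
    IsPushout T.hom.appTop (geomPt F).hom.appTop (fst T (geomPt F)).left.appTop
      (snd T (geomPt F)).left.appTop := by
  have := isIso_pushoutSection_of_isQuasiSeparated_of_flat_right
    (isPullback_fst_snd T (geomPt F)) (US := ⊤) (UT := ⊤) (UX := ⊤) (UY := ⊤) le_top le_top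
    (by simp) (isAffineOpen_top _) (isAffineOpen_top _) isCompact_univ isQuasiSeparated_univ
  have := (isIso_pushoutSection_iff _ _ _ _).mp this
  simp only [← Scheme.Hom.appLE_eq_app, Scheme.Hom.appTop]
  exact this

/-- The structure map `F → Γ(T)` of an `F`-scheme. -/
def structΓ (T : Sch F) : CommRingCat.of F ⟶ Γ(T.left, ⊤) :=
  (Scheme.ΓSpecIso _).inv ≫ T.hom.appTop

/-- The identification `Γ(Spec F̄) = F̄`. -/
def geomΓIso : Γ((geomPt F).left, ⊤) ≅ .of (SeparableClosure F) :=
  Scheme.ΓSpecIso (.of (SeparableClosure F))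

lemma geomΓIso_inv_galPt (s : AbsGal F) :
    geomΓIso.inv ≫ (galPt s).left.appTop =
      CommRingCat.ofHom (s : SeparableClosure F →+* SeparableClosure F) ≫ geomΓIso.inv :=
  (Scheme.ΓSpecIso_inv_naturality _).symm

lemma algebraMap_geomΓIso_inv :
    CommRingCat.ofHom (algebraMap F (SeparableClosure F)) ≫ geomΓIso.inv =
      (Scheme.ΓSpecIso (.of F)).inv ≫ (geomPt F).hom.appTop :=
  Scheme.ΓSpecIso_inv_naturality _

/-- The map `F̄ → Γ(S)` attached to a morphism `S ⟶ Spec F̄`. -/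
def geomΓ {S : Sch F} (κ : S ⟶ geomPt F) : CommRingCat.of (SeparableClosure F) ⟶ Γ(S.left, ⊤) :=
  geomΓIso.inv ≫ κ.left.appTop

lemma structΓ_comp {S T : Sch F} (x : S ⟶ T) : structΓ T ≫ x.left.appTop = structΓ S := by
  rw [structΓ, structΓ, Category.assoc, ← Scheme.Hom.comp_appTop, Over.w]

lemma geomΓ_comp {S T : Sch F} (x : S ⟶ T) (κ : T ⟶ geomPt F) :
    geomΓ κ ≫ x.left.appTop = geomΓ (x ≫ κ) := by
  rw [geomΓ, geomΓ, Category.assoc, ← Scheme.Hom.comp_appTop, Over.comp_left]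

lemma geomΓ_galPt {S : Sch F} (κ : S ⟶ geomPt F) (s : AbsGal F) :
    geomΓ (κ ≫ galPt s) =
      CommRingCat.ofHom (s : SeparableClosure F →+* SeparableClosure F) ≫ geomΓ κ := by
  rw [geomΓ, geomΓ, Over.comp_left, Scheme.Hom.comp_appTop, ← Category.assoc, geomΓIso_inv_galPt,
    Category.assoc]

lemma algebraMap_geomΓ {S : Sch F} (κ : S ⟶ geomPt F) :
    CommRingCat.ofHom (algebraMap F (SeparableClosure F)) ≫ geomΓ κ = structΓ S := by
  rw [geomΓ, structΓ, ← Over.w κ, Scheme.Hom.comp_appTop, ← Category.assoc,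
    algebraMap_geomΓIso_inv, Category.assoc]

lemma isPushout_geomΓ (T : Sch F) [CompactSpace T.left] [QuasiSeparatedSpace T.left] :
    IsPushout (structΓ T) (CommRingCat.ofHom (algebraMap F (SeparableClosure F)))
      (fst T (geomPt F)).left.appTop (geomΓ (snd T (geomPt F))) :=
  (isPushout_appTop T).of_iso (Scheme.ΓSpecIso _) (.refl _) geomΓIso (.refl _)
    (by simp [structΓ])
    (by rw [← Iso.inv_comp_eq, ← Category.assoc, ← algebraMap_geomΓIso_inv]; simp)
    (by simp) (by simp [geomΓ])

/-- The function ring `Γ(T)` as an `F`-algebra. -/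
abbrev algΓ (T : Sch F) : Algebra F Γ(T.left, ⊤) := (structΓ T).hom.toAlgebra

/-- A morphism `S ⟶ Spec F̄` makes `Γ(S)` an `F̄`-algebra. -/
abbrev algGeomΓ {S : Sch F} (κ : S ⟶ geomPt F) : Algebra (SeparableClosure F) Γ(S.left, ⊤) :=
  (geomΓ κ).hom.toAlgebra

lemma exists_tensor_equiv (T : Sch F) [CompactSpace T.left] [QuasiSeparatedSpace T.left] :
    letI := algΓ T
    ∃ e : Γ(T.left, ⊤) ⊗[F] SeparableClosure F ≃+* Γ((T ⊗ geomPt F).left, ⊤),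
      ∀ r c, e (r ⊗ₜ c) = (fst T (geomPt F)).left.appTop r * geomΓ (snd T (geomPt F)) c := by
  let := algΓ T
  let := algΓ (T ⊗ geomPt F)
  let := algGeomΓ (snd T (geomPt F))
  let : Algebra Γ(T.left, ⊤) Γ((T ⊗ geomPt F).left, ⊤) :=
    (fst T (geomPt F)).left.appTop.hom.toAlgebra
  have : IsScalarTower F Γ(T.left, ⊤) Γ((T ⊗ geomPt F).left, ⊤) :=
    .of_algebraMap_eq' (congrArg CommRingCat.Hom.hom (structΓ_comp (fst T (geomPt F))).symm)
  have : IsScalarTower F (SeparableClosure F) Γ((T ⊗ geomPt F).left, ⊤) :=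
    .of_algebraMap_eq' (congrArg CommRingCat.Hom.hom (algebraMap_geomΓ (snd T (geomPt F))).symm)
  have : Algebra.IsPushout F Γ(T.left, ⊤) (SeparableClosure F) Γ((T ⊗ geomPt F).left, ⊤) :=
    CommRingCat.isPushout_iff_isPushout.mp (isPushout_geomΓ T)
  refine ⟨(Algebra.IsPushout.equiv F Γ(T.left, ⊤) (SeparableClosure F)
    Γ((T ⊗ geomPt F).left, ⊤)).toRingEquiv, fun r c => ?_⟩
  exact (Algebra.IsPushout.equiv_tmul F Γ(T.left, ⊤) (SeparableClosure F)
    Γ((T ⊗ geomPt F).left, ⊤) r c).trans rfl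

lemma appTop_fst_injective (T : Sch F) [CompactSpace T.left] [QuasiSeparatedSpace T.left] :
    Function.Injective (fst T (geomPt F)).left.appTop := by
  let := algΓ T
  obtain ⟨e, he⟩ := exists_tensor_equiv T
  intro r r' h
  have := Algebra.TensorProduct.includeLeft_injective (R := F) (S := F) (A := Γ(T.left, ⊤))
    (B := SeparableClosure F) (algebraMap F (SeparableClosure F)).injective
  refine this (e.injective ?_)
  change e (r ⊗ₜ 1) = e (r' ⊗ₜ 1)
  rw [he, he, h]

/-- A Galois-invariant function on `T ×_F F̄` comes from a function on `T`. -/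
lemma exists_appTop_fst_eq (T : Sch F) [CompactSpace T.left] [QuasiSeparatedSpace T.left]
    (m : Γ((T ⊗ geomPt F).left, ⊤)) (hm : ∀ s : AbsGal F, (T ◁ galPt s).left.appTop m = m) :
    ∃ r, (fst T (geomPt F)).left.appTop r = m := by
  let := algΓ T
  obtain ⟨e, he⟩ := exists_tensor_equiv T
  obtain ⟨z, rfl⟩ := e.surjective m
  have key : ∀ (s : AbsGal F) z, (T ◁ galPt s).left.appTop (e z) =
      e (TensorProduct.map LinearMap.id s.toLinearMap z) := by
    intro s z
    induction z using TensorProduct.induction_on with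
    | zero => simp
    | add x y hx hy => rw [map_add, map_add, hx, hy, map_add, map_add]
    | tmul r c =>
      have h1 : (T ◁ galPt s).left.appTop ((fst T (geomPt F)).left.appTop r) =
          (fst T (geomPt F)).left.appTop r := by
        rw [← CommRingCat.comp_apply, ← Scheme.Hom.comp_appTop, ← Over.comp_left,
          whiskerLeft_fst]
      have h2 : (T ◁ galPt s).left.appTop (geomΓ (snd T (geomPt F)) c) =
          geomΓ (snd T (geomPt F)) (s c) := by
        rw [← CommRingCat.comp_apply, geomΓ_comp, whiskerLeft_snd, geomΓ_galPt]
        rfl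
      rw [he, map_mul, h1, h2, TensorProduct.map_tmul, he]
      rfl
  obtain ⟨r, rfl⟩ := GaloisDescent.exists_tmul_one_of_invariant z fun s =>
    e.injective (by rw [← key, hm])
  exact ⟨r, by rw [he, map_one, _root_.mul_one]⟩

/-- Galois descent for morphisms to an affine scheme. -/
theorem exists_fst_comp_eq {T X : Sch F} [CompactSpace T.left] [QuasiSeparatedSpace T.left]
    [IsAffine X.left] (x : T ⊗ geomPt F ⟶ X) (hx : ∀ s : AbsGal F, T ◁ galPt s ≫ x = x) :
    ∃ y : T ⟶ X, fst T (geomPt F) ≫ y = x := by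
  have hinj := appTop_fst_injective T
  have hex : ∀ a, ∃ r, (fst T (geomPt F)).left.appTop r = x.left.appTop a := fun a =>
    exists_appTop_fst_eq T _ fun s => by
      rw [← CommRingCat.comp_apply, ← Scheme.Hom.comp_appTop, ← Over.comp_left, hx]
  choose φ hφ using hex
  let ψ : Γ(X.left, ⊤) →+* Γ(T.left, ⊤) :=
    { toFun := φ
      map_one' := hinj (by rw [hφ, map_one, map_one])
      map_mul' := fun a b => hinj (by rw [hφ, map_mul, map_mul, hφ, hφ])
      map_zero' := hinj (by rw [hφ, map_zero, map_zero])
      map_add' := fun a b => hinj (by rw [hφ, map_add, map_add, hφ, hφ]) }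
  have hψ : CommRingCat.ofHom ψ ≫ (fst T (geomPt F)).left.appTop = x.left.appTop := by
    ext a
    exact hφ a
  let y : T.left ⟶ X.left := T.left.toSpecΓ ≫ Spec.map (CommRingCat.ofHom ψ) ≫ X.left.isoSpec.inv
  have hy : (fst T (geomPt F)).left ≫ y = x.left := by
    rw [Scheme.toSpecΓ_naturality_assoc, ← Spec.map_comp_assoc, hψ,
      ← Scheme.toSpecΓ_naturality_assoc, Scheme.toSpecΓ_isoSpec_inv, Category.comp_id]
  refine ⟨Over.homMk y ?_, Over.OverMorphism.ext hy⟩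
  rw [← cancel_epi (fst T (geomPt F)).left, reassoc_of% hy, Over.w, Over.w]

/-- A quasi-compact quasi-separated `F`-scheme is affine if it becomes affine over `F̄`. -/
theorem isAffine_of_isAffine_tensor_geomPt (T : Sch F) [CompactSpace T.left]
    [QuasiSeparatedSpace T.left] [IsAffine (T ⊗ geomPt F).left] : IsAffine T.left := by
  have hR := isPullback_SpecMap_of_isPushout _ _ _ _ (isPushout_appTop T)
  have hout : IsPullback (fst T (geomPt F)).left
      ((T ⊗ geomPt F).left.toSpecΓ ≫ Spec.map (snd T (geomPt F)).left.appTop)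
      (T.left.toSpecΓ ≫ Spec.map T.hom.appTop) (Spec.map (geomPt F).hom.appTop) := by
    rw [← Scheme.toSpecΓ_naturality, ← Scheme.toSpecΓ_naturality]
    exact (isPullback_fst_snd T (geomPt F)).of_iso (.refl _) (.refl _) (geomPt F).left.isoSpec
      (Spec (.of F)).isoSpec (by simp) (by simp [Scheme.isoSpec]) (by simp [Scheme.isoSpec])
      (Scheme.isoSpec_hom_naturality _).symm
  have hL : IsPullback (fst T (geomPt F)).left (T ⊗ geomPt F).left.toSpecΓ T.left.toSpecΓ
      (Spec.map (fst T (geomPt F)).left.appTop) :=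
    IsPullback.of_bot hout (Scheme.toSpecΓ_naturality _) hR
  have h1 : (@Surjective ⊓ @Flat ⊓ @QuasiCompact : MorphismProperty Scheme.{u})
      (Spec.map (fst T (geomPt F)).left.appTop) := by
    have : (@Surjective ⊓ @Flat ⊓ @QuasiCompact : MorphismProperty Scheme.{u})
        (Spec.map (geomPt F).hom.appTop) := by
      have : Spec.map (geomPt F).hom.appTop =
          (geomPt F).left.isoSpec.inv ≫ (geomPt F).hom ≫ (Spec (.of F)).isoSpec.hom := by
        rw [← Scheme.isoSpec_hom_naturality, Iso.inv_hom_id_assoc]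
      rw [this]
      exact ⟨⟨inferInstance, inferInstance⟩, inferInstance⟩
    obtain ⟨⟨h₁, h₂⟩, h₃⟩ := this
    exact ⟨⟨MorphismProperty.of_isPullback hR.flip h₁, MorphismProperty.of_isPullback hR.flip h₂⟩,
      MorphismProperty.of_isPullback hR.flip h₃⟩
  have h2 : IsIso T.left.toSpecΓ :=
    MorphismProperty.of_isPullback_of_descendsAlong (P := .isomorphisms Scheme.{u}) hL.flip h1
      (inferInstanceAs (IsIso (T ⊗ geomPt F).left.toSpecΓ))
  exact ⟨h2⟩

end Functions

/-! ### Forms of affine schemes -/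

section Forms

variable {F : Type u} [Field F]

lemma setOf_apply_eq_mem_nhds (c : SeparableClosure F) :
    {s : AbsGal F | s c = c} ∈ 𝓝 (1 : AbsGal F) := by
  refine (krullTopology_mem_nhds_one_iff F (SeparableClosure F) _).mpr
    ⟨IntermediateField.adjoin F {c}, IntermediateField.adjoin.finiteDimensional
      (Algebra.IsIntegral.isIntegral c), fun s hs => ?_⟩
  exact (IntermediateField.mem_fixingSubgroup_iff _ _).mp hs c
    (IntermediateField.mem_adjoin_simple_self F c)

lemma toSpecΓ_structΓ (S : Sch F) : S.left.toSpecΓ ≫ Spec.map (structΓ S) = S.hom := by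
  rw [structΓ, Spec.map_comp, ← Scheme.toSpecΓ_naturality_assoc, toSpecΓ_SpecMap_ΓSpecIso_inv,
    Category.comp_id]

lemma toSpecΓ_geomΓ {S : Sch F} (κ : S ⟶ geomPt F) :
    S.left.toSpecΓ ≫ Spec.map (geomΓ κ) = κ.left := by
  have h : (geomPt F).left.toSpecΓ ≫ Spec.map geomΓIso.inv = 𝟙 _ :=
    toSpecΓ_SpecMap_ΓSpecIso_inv _
  rw [geomΓ, Spec.map_comp, ← Scheme.toSpecΓ_naturality_assoc]
  exact (congrArg (κ.left ≫ ·) h).trans (Category.comp_id _)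

lemma isIso_lift_of_isPullback {Z P S : Sch F} (p : Z ⟶ P) (q : Z ⟶ S)
    (h : IsPullback p.left q.left P.hom S.hom) : IsIso (lift p q) := by
  have : IsIso (lift p q).left := by
    have : (lift p q).left = h.isoPullback.hom := by
      apply Limits.pullback.hom_ext
      · exact (congrArg CommaMorphism.left (lift_fst p q)).trans h.isoPullback_hom_fst.symm
      · exact (congrArg CommaMorphism.left (lift_snd p q)).trans h.isoPullback_hom_snd.symm
    rw [this]; infer_instance
  have : IsIso ((Over.forget _).map (lift p q)) := this
  exact isIso_of_reflects_iso (lift p q) (Over.forget _)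

/-- Descent of affine schemes along `F̄/F`: a semilinear action of the Galois group on `Y ×_F F̄`
(with `Y` affine) for which an open subgroup acts in the standard way comes from an `F`-scheme `P`,
the spectrum of the ring of invariants. -/
theorem exists_form {Y : Sch F} [IsAffine Y.left]
    (t : AbsGal F → (Y ⊗ geomPt F ⟶ Y ⊗ geomPt F)) (ht1 : t 1 = 𝟙 _)
    (htm : ∀ s s', t (s * s') = t s ≫ t s')
    (hts : ∀ s, t s ≫ snd _ _ = snd _ _ ≫ galPt s)
    (hto : {s | t s ≫ fst _ _ = fst _ _} ∈ 𝓝 (1 : AbsGal F)) :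
    ∃ (P : Sch F) (_ : IsAffine P.left) (π : Y ⊗ geomPt F ⟶ P), (∀ s, t s ≫ π = π) ∧
      IsIso (lift π (snd Y (geomPt F))) := by
  let M := Γ((Y ⊗ geomPt F).left, ⊤)
  let _ := algΓ (Y ⊗ geomPt F)
  let _ := algGeomΓ (snd Y (geomPt F))
  have : IsScalarTower F (SeparableClosure F) Γ((Y ⊗ geomPt F).left, ⊤) :=
    .of_algebraMap_eq' (congrArg CommRingCat.Hom.hom (algebraMap_geomΓ (snd Y (geomPt F))).symm)
  let ρ : Gal(SeparableClosure F/F) →* AddMonoid.End Γ((Y ⊗ geomPt F).left, ⊤) :=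
    { toFun := fun s => ((t s).left.appTop.hom : M →+* M).toAddMonoidHom
      map_one' := by
        ext m
        change (t 1).left.appTop m = m
        rw [ht1, Over.id_left, Scheme.Hom.id_appTop, CommRingCat.id_apply]
      map_mul' := fun s s' => by
        ext m
        change (t (s * s')).left.appTop m = (t s).left.appTop ((t s').left.appTop m)
        rw [htm, Over.comp_left, Scheme.Hom.comp_appTop, CommRingCat.comp_apply] }
  have hρapp : ∀ s m, ρ s m = (t s).left.appTop m := fun _ _ => rfl
  have hgeom : ∀ s (c : SeparableClosure F), (t s).left.appTop (geomΓ (snd Y (geomPt F)) c) =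
      geomΓ (snd Y (geomPt F)) (s c) := fun s c => by
    rw [← CommRingCat.comp_apply, geomΓ_comp, hts, geomΓ_galPt]
    rfl
  have hρ : GaloisDescent.IsSemilinear ρ := fun s c m => by
    rw [Algebra.smul_def, Algebra.smul_def, hρapp, map_mul, hρapp]
    exact congrArg (· * _) (hgeom s c)
  have hopen : ∀ m, {s | ρ s m = m} ∈ 𝓝 (1 : Gal(SeparableClosure F/F)) := by
    intro m
    let _ := algΓ Y
    obtain ⟨e, he⟩ := exists_tensor_equiv Y
    obtain ⟨z, rfl⟩ := e.surjective m
    induction z using TensorProduct.induction_on with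
    | zero => simp
    | add x y hx hy =>
      filter_upwards [hx, hy] with s h1 h2
      rw [map_add, map_add, h1, h2]
    | tmul r c =>
      filter_upwards [hto, setOf_apply_eq_mem_nhds c] with s h1 h2
      rw [he, hρapp, map_mul, hgeom, h2, ← CommRingCat.comp_apply, ← Scheme.Hom.comp_appTop,
        ← Over.comp_left, h1]
  let B : Subalgebra F Γ((Y ⊗ geomPt F).left, ⊤) :=
    { GaloisDescent.invariants ρ hρ with
      mul_mem' := fun {a b} ha hb s => by
        rw [hρapp, map_mul]; exact congrArg₂ (· * ·) (ha s) (hb s)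
      algebraMap_mem' := fun r s => by
        rw [IsScalarTower.algebraMap_apply F (SeparableClosure F), hρapp]
        exact (hgeom s _).trans (congrArg _ (s.commutes r)) }
  have hB : IsBaseChange (SeparableClosure F) (IsScalarTower.toAlgHom F B
      Γ((Y ⊗ geomPt F).left, ⊤)).toLinearMap :=
    GaloisDescent.isBaseChange_invariants ρ hρ hopen
  have hBp : Algebra.IsPushout F (SeparableClosure F) B Γ((Y ⊗ geomPt F).left, ⊤) := ⟨hB⟩
  have hpo := CommRingCat.isPushout_iff_isPushout.mpr hBp.symm
  have hpb := isPullback_SpecMap_of_isPushout _ _ _ _ hpo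
  let P : Sch F := Over.mk (Spec.map (CommRingCat.ofHom (algebraMap F B)))
  let j : CommRingCat.of B ⟶ Γ((Y ⊗ geomPt F).left, ⊤) :=
    CommRingCat.ofHom (algebraMap B Γ((Y ⊗ geomPt F).left, ⊤))
  let π₀ : (Y ⊗ geomPt F).left ⟶ P.left := (Y ⊗ geomPt F).left.toSpecΓ ≫ Spec.map j
  let π : Y ⊗ geomPt F ⟶ P := Over.homMk π₀ (by
    refine Eq.trans ?_ (toSpecΓ_structΓ (Y ⊗ geomPt F))
    change (_ ≫ Spec.map j) ≫ Spec.map _ = _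
    rw [Category.assoc, ← Spec.map_comp]
    rfl)
  refine ⟨P, inferInstanceAs (IsAffine (Spec _)), π, fun s => ?_, isIso_lift_of_isPullback _ _ ?_⟩
  · apply Over.OverMorphism.ext
    change (t s).left ≫ (Y ⊗ geomPt F).left.toSpecΓ ≫ Spec.map j =
      (Y ⊗ geomPt F).left.toSpecΓ ≫ Spec.map j
    rw [Scheme.toSpecΓ_naturality_assoc, ← Spec.map_comp]
    congr 2
    ext b
    exact b.2 s
  · refine hpb.of_iso (Y ⊗ geomPt F).left.isoSpec.symm (.refl _) (.refl _) (.refl _) ?_ ?_ ?_ ?_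
    · simp [π, π₀, Scheme.isoSpec, j]
    · refine (Category.comp_id _).trans ?_
      exact (Iso.eq_inv_comp _).mpr (toSpecΓ_geomΓ (snd Y (geomPt F)))
    · simp [P]
    · simp [geomPt]

end Forms

/-! ### Geometric points of smooth schemes -/

section Points

variable {F : Type u} [Field F]

instance infinite_of_isSepClosed (K : Type*) [Field K] [IsSepClosed K] : Infinite K := by
  by_contra h
  rw [not_infinite_iff_finite] at h
  have := IsSepClosed.isAlgClosed_of_perfectField K
  exact not_finite K

/-- Some nonempty basic open of `Y` is étale over an affine space, and its image there contains a
nonempty open set. As `F̄` is infinite, this set has an `F̄`-point, which lifts along the étale map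
because `F̄` is separably closed. -/
lemma exists_geomPt_of_isAffine (Y : Sch F) [IsAffine Y.left] [Smooth Y.hom] [Nonempty Y.left] :
    Nonempty (geomPt F ⟶ Y) := by
  let _ := algΓ Y
  have hsm : Algebra.Smooth F Γ(Y.left, ⊤) := by
    have h1 : Y.hom.appTop.hom.Smooth := HasRingHomProperty.appTop (P := @Smooth) _ inferInstance
    have h2 : (structΓ Y).hom.Smooth :=
      RingHom.Smooth.respectsIso.2 _ (Scheme.ΓSpecIso (.of F)).symm.commRingCatIsoToRingEquiv h1
    exact h2
  obtain ⟨S, hS, hstd⟩ := Algebra.Smooth.exists_span_eq_top_isStandardSmooth (R := F)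
    (S := Γ(Y.left, ⊤))
  have : Nontrivial Γ(Y.left, ⊤) := by
    obtain ⟨y⟩ := (inferInstance : Nonempty Y.left)
    have : Nonempty (⊤ : Y.left.Opens) := ⟨⟨y, trivial⟩⟩
    infer_instance
  have : ∃ f ∈ S, ¬ IsNilpotent f := by
    by_contra! h
    have : Ideal.span S ≤ nilradical _ := Ideal.span_le.mpr h
    rw [hS, top_le_iff, Ideal.eq_top_iff_one, mem_nilradical] at this
    exact not_isNilpotent_one this
  obtain ⟨f, hf, hnil⟩ := this
  let A' := Localization.Away f
  have hA' : Nontrivial A' := by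
    by_contra h
    rw [not_nontrivial_iff_subsingleton] at h
    exact hnil ((IsLocalization.subsingleton_iff (S := A') (M := Submonoid.powers f)).mp h)
  have : Algebra.IsStandardSmooth F A' := hstd f hf
  obtain ⟨n, g, hgC, hg⟩ := (RingHom.isStandardSmooth_algebraMap.mpr this).exists_etale_mvPolynomial
  let G : Spec (.of A') ⟶ Spec (.of (MvPolynomial (Fin n) F)) := Spec.map (CommRingCat.ofHom g)
  have hG : Etale G := (HasRingHomProperty.Spec_iff (P := @Etale)).mpr hg
  obtain ⟨x₀⟩ : Nonempty (Spec (.of A')) := inferInstanceAs (Nonempty (PrimeSpectrum A'))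
  obtain ⟨_, ⟨_, ⟨q, rfl⟩, rfl⟩, hxq, hq⟩ := (PrimeSpectrum.isBasis_basic_opens
    (R := MvPolynomial (Fin n) F)).exists_subset_of_mem_open (Set.mem_range_self x₀)
      G.isOpenMap.isOpen_range
  have hq0 : q ≠ 0 := by
    rintro rfl
    exact hxq (Ideal.zero_mem _)
  obtain ⟨v, hv⟩ : ∃ v : Fin n → SeparableClosure F, MvPolynomial.aeval v q ≠ 0 := by
    by_contra! h
    refine hq0 (MvPolynomial.map_injective _ (algebraMap F (SeparableClosure F)).injective
      (MvPolynomial.funext fun v => ?_))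
    rw [map_zero, map_zero, MvPolynomial.eval_map, ← MvPolynomial.aeval_def, h]
  let s : Spec (.of (SeparableClosure F)) ⟶ Spec (.of (MvPolynomial (Fin n) F)) :=
    Spec.map (CommRingCat.ofHom (MvPolynomial.aeval v).toRingHom)
  have hs : s default ∈ Set.range G := hq fun hmem => by
    have : (default : Spec (.of (SeparableClosure F))).asIdeal = ⊤ :=
      Ideal.eq_top_of_isUnit_mem _ hmem (isUnit_iff_ne_zero.mpr hv)
    exact (default : Spec (.of (SeparableClosure F))).isPrime.ne_top this
  obtain ⟨x, hx⟩ := hs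
  obtain ⟨l, hl, -⟩ := Scheme.exists_fac_of_etale_of_isSepClosed G s x hx
  let a : Γ(Y.left, ⊤) ⟶ .of A' := CommRingCat.ofHom (algebraMap _ A')
  have ha : structΓ Y ≫ a = CommRingCat.ofHom MvPolynomial.C ≫ CommRingCat.ofHom g := by
    ext c
    exact (IsScalarTower.algebraMap_apply F Γ(Y.left, ⊤) A' c).symm.trans
      (RingHom.congr_fun hgC c).symm
  refine ⟨Over.homMk (l ≫ Spec.map a ≫ Y.left.isoSpec.inv) ?_⟩
  have h1 : Y.left.isoSpec.inv ≫ Y.hom = Spec.map (structΓ Y) :=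
    (Iso.inv_comp_eq _).mpr (toSpecΓ_structΓ Y).symm
  change (l ≫ Spec.map a ≫ Y.left.isoSpec.inv) ≫ Y.hom = specMap F (SeparableClosure F)
  rw [Category.assoc, Category.assoc, h1, ← Spec.map_comp, ha, Spec.map_comp]
  change l ≫ G ≫ _ = _
  rw [reassoc_of% hl, ← Spec.map_comp, ← CommRingCat.ofHom_comp]
  congr 2
  ext c
  simp

lemma exists_geomPt (Y : Sch F) [Smooth Y.hom] [Nonempty Y.left] : Nonempty (geomPt F ⟶ Y) := by
  obtain ⟨y⟩ := (inferInstance : Nonempty Y.left)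
  obtain ⟨_, ⟨U, hU, rfl⟩, hyU, -⟩ :=
    Y.left.isBasis_affineOpens.exists_subset_of_mem_open (Set.mem_univ y) isOpen_univ
  let i : (U : Scheme) ⟶ Y.left := Scheme.Opens.ι U
  let Z : Sch F := Over.mk (i ≫ Y.hom)
  have : IsAffine Z.left := hU
  have : Smooth Z.hom := by dsimp [Z]; infer_instance
  have : Nonempty Z.left := ⟨⟨y, hyU⟩⟩
  exact (exists_geomPt_of_isAffine Z).map fun z => z ≫ Over.homMk i

/-- A point over the separable closure is fixed by an open subgroup of the Galois group, since its
finitely many coordinates generate a finite extension. -/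
lemma setOf_galAct_eq_mem_nhds {Y : Sch F} [IsAffine Y.left] [LocallyOfFiniteType Y.hom]
    (p : geomPt F ⟶ Y) : {s | galAct s p = p} ∈ 𝓝 (1 : AbsGal F) := by
  have hft : (structΓ Y).hom.FiniteType := by
    have h1 : Y.hom.appTop.hom.FiniteType :=
      HasRingHomProperty.appTop (P := @LocallyOfFiniteType) _ inferInstance
    exact RingHom.finiteType_respectsIso.2 _
      (Scheme.ΓSpecIso (.of F)).symm.commRingCatIsoToRingEquiv h1
  let _ := algΓ Y
  obtain ⟨S, hS⟩ := (show Algebra.FiniteType F Γ(Y.left, ⊤) from hft).out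
  let χ := p.left.appTop ≫ geomΓIso.hom
  have hχ : structΓ Y ≫ χ = CommRingCat.ofHom (algebraMap F (SeparableClosure F)) := by
    rw [← Category.assoc, structΓ_comp, structΓ, ← algebraMap_geomΓIso_inv, Category.assoc,
      Iso.inv_hom_id, Category.comp_id]
  have hmem : ∀ T : Finset Γ(Y.left, ⊤),
      {s : AbsGal F | ∀ a ∈ T, s (χ a) = χ a} ∈ 𝓝 (1 : AbsGal F) := fun T => by
    rw [show {s : AbsGal F | ∀ a ∈ T, s (χ a) = χ a} = ⋂ a ∈ T, {s | s (χ a) = χ a} by ext; simp]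
    exact (Filter.biInter_finset_mem T).mpr fun a _ => setOf_apply_eq_mem_nhds _
  filter_upwards [hmem S] with s hs
  let χF : Γ(Y.left, ⊤) →ₐ[F] SeparableClosure F :=
    { χ.hom with commutes' := fun c => congrArg (fun f => f.hom c) hχ }
  have hχs : ((s : SeparableClosure F →ₐ[F] SeparableClosure F).comp χF) = χF :=
    AlgHom.ext_of_adjoin_eq_top hS fun a ha => hs a ha
  have h1 : p.left.appTop ≫ (galPt s).left.appTop = p.left.appTop := by
    rw [← cancel_mono geomΓIso.hom, Category.assoc]
    have : (galPt s).left.appTop ≫ geomΓIso.hom = geomΓIso.hom ≫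
        CommRingCat.ofHom (s : SeparableClosure F →+* SeparableClosure F) := by
      rw [← Iso.inv_comp_eq, ← Category.assoc, geomΓIso_inv_galPt, Category.assoc,
        Iso.inv_hom_id, Category.comp_id]
    rw [this, ← Category.assoc]
    apply CommRingCat.hom_ext
    exact RingHom.ext fun a => show s (χ.hom a) = χ.hom a from DFunLike.congr_fun hχs a
  apply Over.OverMorphism.ext
  apply ext_of_isAffine
  rw [galAct, Over.comp_left, Scheme.Hom.comp_appTop, h1]

end Points

section Torsor
variable {F : Type u} [Field F] {C : CrossedModule F} (X : Bitorsor C)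

/-- The unique `g` with `p * g = q`, for two points `p, q` of a torsor. -/
def Bitorsor.div {T : Sch F} (p q : T ⟶ X.P) : T ⟶ C.G := (X.simply_transitive p q).choose

@[simp]
lemma Bitorsor.lift_div {T : Sch F} (p q : T ⟶ X.P) : lift p (X.div p q) ≫ X.act = q :=
  (X.simply_transitive p q).choose_spec.1

lemma Bitorsor.div_eq {T : Sch F} {p q : T ⟶ X.P} {g : T ⟶ C.G} (h : lift p g ≫ X.act = q) :
    X.div p q = g :=
  ((X.simply_transitive p q).choose_spec.2 g h).symm

lemma Bitorsor.act_injective {T : Sch F} (p : T ⟶ X.P) {g g' : T ⟶ C.G}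
    (h : lift p g ≫ X.act = lift p g' ≫ X.act) : g = g' :=
  (X.div_eq rfl).symm.trans (X.div_eq h.symm)

/-- The isomorphism `P × G ≅ P × P`, as a pullback square exhibiting `P × G → P` as the base change
of `P → Spec F` along itself. -/
lemma isPullback_fst_act : IsPullback (fst X.P C.G).left X.act.left X.P.hom X.P.hom := by
  let i : X.P ⊗ C.G ≅ X.P ⊗ X.P :=
    { hom := lift (fst _ _) X.act
      inv := lift (fst _ _) (X.div (fst _ _) (snd _ _))
      hom_inv_id := by
        apply CartesianMonoidalCategory.hom_ext
        · simp
        · apply X.act_injective (fst X.P C.G)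
          rw [Category.id_comp, lift_fst_snd, Category.id_comp, Category.assoc, lift_snd]
          have := congrArg (lift (fst X.P C.G) X.act ≫ ·) (X.lift_div (fst X.P X.P) (snd _ _))
          simpa only [comp_lift_assoc, lift_fst, lift_snd] using this
      inv_hom_id := by
        apply CartesianMonoidalCategory.hom_ext <;> simp }
  refine (isPullback_fst_snd X.P X.P).of_iso ((Over.forget _).mapIso i.symm) (.refl _) (.refl _)
    (.refl _) ?_ ?_ (by simp) (by simp)
  · exact (Category.comp_id _).trans (congrArg CommaMorphism.left
      (lift_fst (fst X.P X.P) (X.div (fst X.P X.P) (snd X.P X.P)))).symm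
  · exact (Category.comp_id _).trans (congrArg CommaMorphism.left
      (X.lift_div (fst X.P X.P) (snd X.P X.P))).symm

lemma fpqc_hom : (@Surjective ⊓ @Flat ⊓ @QuasiCompact : MorphismProperty Scheme.{u}) X.P.hom := by
  refine ⟨⟨⟨fun y => ?_⟩, inferInstance⟩, inferInstance⟩
  exact ⟨X.nonempty.some, Subsingleton.elim _ _⟩

/-- A torsor under a smooth group is smooth: the base change of `P → Spec F` along itself is the
projection `P × G → P`. -/
instance smooth_hom : Smooth X.P.hom :=
  MorphismProperty.of_isPullback_of_descendsAlong (P := @Smooth) (isPullback_fst_act X)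
    (fpqc_hom X) (by dsimp; infer_instance)

end Torsor

/-! ### The cocycle of a bitorsor with a geometric point -/

section CocycleAt

variable {F : Type u} [Field F] {C : CrossedModule F} (X : Bitorsor C)

lemma galPt_mul (s t : AbsGal F) : galPt (s * t) = galPt s ≫ galPt t := by
  apply Over.OverMorphism.ext
  refine Eq.trans ?_ (Spec.map_comp _ _)
  rfl

lemma galPt_one : galPt (1 : AbsGal F) = 𝟙 _ := by
  apply Over.OverMorphism.ext
  exact Spec.map_id _

lemma Bitorsor.comp_div {S T : Sch F} (t : S ⟶ T) (p q : T ⟶ X.P) :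
    t ≫ X.div p q = X.div (t ≫ p) (t ≫ q) := by
  refine (X.div_eq ?_).symm
  rw [← comp_lift_assoc, X.lift_div]

lemma Bitorsor.comp_act {S T : Sch F} (t : S ⟶ T) (p : T ⟶ X.P) (g : T ⟶ C.G) :
    t ≫ lift p g ≫ X.act = lift (t ≫ p) (t ≫ g) ≫ X.act := by
  rw [comp_lift_assoc]

instance : CompactSpace X.P.left := QuasiCompact.compactSpace_of_compactSpace X.P.hom

instance : QuasiSeparatedSpace X.P.left :=
  quasiSeparatedSpace_of_quasiSeparated X.P.hom

lemma Bitorsor.exists_point : Nonempty (geomPt F ⟶ X.P) := exists_geomPt X.P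

/-- A torsor under an affine group is affine, since it becomes isomorphic to the group over `F̄`. -/
instance : IsAffine X.P.left := by
  obtain ⟨p⟩ := X.exists_point
  let θ : X.P ⊗ geomPt F ≅ C.G ⊗ geomPt F :=
    { hom := lift (X.div (snd _ _ ≫ p) (fst _ _)) (snd _ _)
      inv := lift (lift (snd _ _ ≫ p) (fst _ _) ≫ X.act) (snd _ _)
      hom_inv_id := by
        apply CartesianMonoidalCategory.hom_ext
        · simp [comp_lift_assoc]
        · simp
      inv_hom_id := by
        apply CartesianMonoidalCategory.hom_ext
        · rw [Category.assoc, lift_fst, X.comp_div, Category.id_comp]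
          apply X.div_eq
          simp
        · simp }
  let e : (X.P ⊗ geomPt F).left ≅ (C.G ⊗ geomPt F).left := (Over.forget _).mapIso θ
  have : IsAffine (X.P ⊗ geomPt F).left := .of_isIso e.hom
  exact isAffine_of_isAffine_tensor_geomPt X.P

/-- `(α, h)` is the cocycle of the bitorsor `(P, f)` at the point `p ∈ P(F̄)` when `ˢp = p * α_s`
and `h = f(p)⁻¹`. The inverse turns right multiplication, in the relation `f(p * g) = f(p) ∂(g)`,
into the left multiplication that occurs in the definition of cohomologous cocycles. -/
structure IsCocycleAt (p : geomPt F ⟶ X.P) (a : Cocycle C) : Prop where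
  h_eq : a.h = (p ≫ X.f)⁻¹
  act_α : ∀ s, lift p (a.α s) ≫ X.act = galAct s p

variable {X}

lemma IsCocycleAt.α_eq {p : geomPt F ⟶ X.P} {a : Cocycle C} (h : IsCocycleAt X p a) (s : AbsGal F) :
    a.α s = X.div p (galAct s p) := (X.div_eq (h.act_α s)).symm

lemma galAct_galAct {Y : Sch F} (s t : AbsGal F) (y : geomPt F ⟶ Y) :
    galAct s (galAct t y) = galAct (s * t) y := by
  rw [galAct, galAct, galAct, galPt_mul, Category.assoc]

lemma galAct_act (s : AbsGal F) (p : geomPt F ⟶ X.P) (g : geomPt F ⟶ C.G) :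
    galAct s (lift p g ≫ X.act) = lift (galAct s p) (galAct s g) ≫ X.act :=
  X.comp_act _ _ _

lemma isLocallyConstant_div (p : geomPt F ⟶ X.P) :
    IsLocallyConstant fun s : AbsGal F => X.div p (galAct s p) := by
  refine (IsLocallyConstant.iff_eventually_eq _).mpr fun s => ?_
  have h : Filter.Tendsto (fun t : AbsGal F => s⁻¹ * t) (𝓝 s) (𝓝 1) := by
    have := (continuous_const_mul s⁻¹).tendsto s
    rwa [inv_mul_cancel] at this
  have h1 : ∀ᶠ t in 𝓝 (1 : AbsGal F), galAct t p = p := setOf_galAct_eq_mem_nhds p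
  filter_upwards [h.eventually h1] with t h2
  have h3 : galAct t p = galAct s p := by
    have := congrArg (galAct s) h2
    rwa [galAct_galAct, mul_inv_cancel_left] at this
  rw [h3]

lemma exists_isCocycleAt (p : geomPt F ⟶ X.P) : ∃ a, IsCocycleAt X p a := by
  refine ⟨⟨fun s => X.div p (galAct s p), (p ≫ X.f)⁻¹, isLocallyConstant_div p, fun s t => ?_,
    fun s => ?_⟩, rfl, fun s => X.lift_div _ _⟩
  · apply X.div_eq
    rw [X.act_mul, X.lift_div, ← galAct_act, X.lift_div, galAct_galAct]
  · have h := X.f_act p (X.div p (galAct s p))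
    rw [X.lift_div] at h
    have h2 : galAct s (p ≫ X.f)⁻¹ = (galAct s p ≫ X.f)⁻¹ := by
      rw [galAct, GrpObj.comp_inv, galAct, Category.assoc]
    rw [h2, h, mul_inv_rev, mul_inv_cancel_left]

/-- The cocycles at two points `p` and `q` differ by the coboundary of the `g` with `q * g = p`. -/
lemma IsCocycleAt.cohomologous {p q : geomPt F ⟶ X.P} {a b : Cocycle C} (ha : IsCocycleAt X p a)
    (hb : IsCocycleAt X q b) : Cohomologous a b := by
  refine ⟨X.div q p, ?_, fun s => ?_⟩
  · have h := X.f_act q (X.div q p)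
    rw [X.lift_div] at h
    rw [ha.h_eq, hb.h_eq, h, mul_inv_rev, mul_inv_cancel_left]
  · rw [hb.α_eq]
    apply X.div_eq
    rw [X.act_mul, X.act_mul, X.lift_div, ha.act_α]
    have h : galAct s p = lift (galAct s q) (galAct s (X.div q p)) ≫ X.act := by
      rw [← galAct_act, X.lift_div]
    rw [h, ← X.act_mul, ← galAct_mul, mul_inv_cancel, galAct_one, X.act_one]

/-- Moving the point by `g⁻¹` changes the cocycle by the coboundary of `g`. -/
lemma IsCocycleAt.of_cohomologous {p : geomPt F ⟶ X.P} {a b : Cocycle C} (ha : IsCocycleAt X p a)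
    (hab : Cohomologous a b) : ∃ q, IsCocycleAt X q b := by
  obtain ⟨g, h1, h2⟩ := hab
  refine ⟨lift p g⁻¹ ≫ X.act, ?_, fun s => ?_⟩
  · rw [X.f_act, h1, ha.h_eq, mul_inv_rev, GrpObj.inv_comp, inv_inv]
  · rw [h2, ← X.act_mul, ← _root_.mul_assoc, inv_mul_cancel_left, X.act_mul, ha.act_α, galAct_act]

end CocycleAt

/-! ### Equivariant morphisms from equality of cocycles -/

section Equivariant

variable {F : Type u} [Field F] {C C' : CrossedModule F} {φ : C.Hom C'} {X : Bitorsor C}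
  {Y : Bitorsor C'}

lemma IsCocycleAt.map (u : EquivariantHom φ X Y) {p : geomPt F ⟶ X.P} {a : Cocycle C}
    (ha : IsCocycleAt X p a) : IsCocycleAt Y (p ≫ u.hom) (a.map φ) := by
  refine ⟨?_, fun s => ?_⟩
  · rw [Category.assoc, u.comp_f]
    simp [Cocycle.map, ha.h_eq, GrpObj.inv_comp]
  · simp only [Cocycle.map]
    rw [← u.equivariant, ha.act_α, galAct, galAct, Category.assoc]

/-- If the cocycle of `Y` at `q` is the image of that of `X` at `p`, then `p * g ↦ q * φ(g)` is
Galois equivariant, so it descends to a morphism over `F`. -/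
theorem IsCocycleAt.exists_equivariantHom {p : geomPt F ⟶ X.P} {a : Cocycle C}
    (ha : IsCocycleAt X p a) {q : geomPt F ⟶ Y.P} (hb : IsCocycleAt Y q (a.map φ)) :
    ∃ u : EquivariantHom φ X Y, p ≫ u.hom = q := by
  let d₀ : X.P ⊗ geomPt F ⟶ C.G := X.div (snd _ _ ≫ p) (fst _ _)
  let v : X.P ⊗ geomPt F ⟶ Y.P := lift (snd _ _ ≫ q) (d₀ ≫ φ.homG) ≫ Y.act
  have hα : ∀ s, lift q (a.α s ≫ φ.homG) ≫ Y.act = galAct s q := fun s => hb.act_α s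
  have hd₀ : ∀ s : AbsGal F, d₀ = (snd _ _ ≫ a.α s) * (X.P ◁ galPt s ≫ d₀) := fun s => by
    apply X.div_eq
    have h1 : lift (snd X.P (geomPt F) ≫ p) (snd X.P (geomPt F) ≫ a.α s) ≫ X.act =
        X.P ◁ galPt s ≫ snd _ _ ≫ p := by
      rw [← X.comp_act, ha.act_α, galAct, whiskerLeft_snd_assoc]
    rw [X.act_mul, h1, ← X.comp_act, X.lift_div, whiskerLeft_fst]
  have hv : ∀ s : AbsGal F, X.P ◁ galPt s ≫ v = v := fun s => by
    have h1 : X.P ◁ galPt s ≫ snd X.P (geomPt F) ≫ q =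
        lift (snd X.P (geomPt F) ≫ q) (snd X.P (geomPt F) ≫ a.α s ≫ φ.homG) ≫ Y.act := by
      rw [← Y.comp_act, hα, galAct, whiskerLeft_snd_assoc]
    have h2 : d₀ ≫ φ.homG = (snd _ _ ≫ a.α s ≫ φ.homG) * (X.P ◁ galPt s ≫ d₀ ≫ φ.homG) := by
      conv_lhs => rw [hd₀ s]
      rw [mul_comp, Category.assoc, Category.assoc]
    rw [Y.comp_act, h1, ← Y.act_mul, ← h2]
  obtain ⟨u, hu⟩ := exists_fst_comp_eq v hv
  -- evaluation of `v` at the points `p(κ) * g`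
  have hval : ∀ {T : Sch F} (x : T ⟶ X.P) (κ : T ⟶ geomPt F) (g : T ⟶ C.G),
      lift (κ ≫ p) g ≫ X.act = x → x ≫ u = lift (κ ≫ q) (g ≫ φ.homG) ≫ Y.act := by
    intro T x κ g hg
    have h1 : x ≫ u = lift x κ ≫ v := by rw [← hu, lift_fst_assoc]
    have h2 : lift x κ ≫ d₀ = g := by
      rw [X.comp_div]
      apply X.div_eq
      simpa using hg
    rw [h1, Y.comp_act, lift_snd_assoc, reassoc_of% h2]
  refine ⟨⟨u, fun {T} x g => ?_, ?_⟩, ?_⟩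
  -- equivariance is checked over `T ×_F F̄`, where every point has the form `p * d`
  · rw [← cancel_epi (fst T (geomPt F))]
    let d := X.div (snd T (geomPt F) ≫ p) (fst _ _ ≫ x)
    have hd : lift (snd T (geomPt F) ≫ p) d ≫ X.act = fst _ _ ≫ x := X.lift_div _ _
    have h1 := hval _ (snd T (geomPt F)) d hd
    have h2 := hval (fst T (geomPt F) ≫ lift x g ≫ X.act) (snd T (geomPt F))
      (d * (fst _ _ ≫ g)) (by rw [X.act_mul, hd, X.comp_act])
    rw [Category.assoc, Category.assoc] at h2
    rw [Category.assoc, h2, Y.comp_act, ← Category.assoc _ x u, h1, mul_comp, Y.act_mul,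
      Category.assoc]
  -- both sides of `f' ∘ u = φ ∘ f` are compared on `p * g`, using `f'(q) = φ(f(p))`
  · rw [← cancel_epi (fst X.P (geomPt F)), reassoc_of% hu, Y.f_act]
    have h1 : q ≫ Y.f = p ≫ X.f ≫ φ.homH := by
      have := hb.h_eq
      simp only [Cocycle.map, ha.h_eq, GrpObj.inv_comp, Category.assoc] at this
      exact (inv_injective this).symm
    have h2 := X.f_act (snd X.P (geomPt F) ≫ p) d₀
    rw [X.lift_div] at h2
    rw [Category.assoc, Category.assoc, h1, φ.comm, ← Category.assoc (fst _ _) X.f φ.homH, h2,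
      mul_comp]
    simp only [Category.assoc]
  · rw [hval p (𝟙 _) 1 (by rw [Category.id_comp, X.act_one]), one_comp, Y.act_one, Category.id_comp]

end Equivariant

/-! ### The bitorsor of a cocycle -/

section Twist

variable {F : Type u} [Field F] {C : CrossedModule F}

lemma Cocycle.α_one (a : Cocycle C) : a.α 1 = 1 := by
  have h := a.cocycle 1 1
  rw [_root_.mul_one, galAct, galPt_one, Category.id_comp] at h
  exact left_eq_mul.mp h

/-- A form of the underlying scheme of `G`, twisted by the cocycle `a`: an affine `F`-scheme `P`
with an isomorphism `P ×_F F̄ ≅ G ×_F F̄` over `F̄`, given by its first component `coord`, such that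
the Galois action on `P ×_F F̄` corresponds to `g ↦ α_s⁻¹ g` composed with that on `G ×_F F̄`. -/
structure TwistedForm (a : Cocycle C) where
  P : Sch F
  [isAffine : IsAffine P.left]
  coord : P ⊗ geomPt F ⟶ C.G
  [isIso_lift : IsIso (lift coord (snd P (geomPt F)))]
  galPt_coord : ∀ s, P ◁ galPt s ≫ coord = (snd _ _ ≫ a.α s)⁻¹ * coord

attribute [instance] TwistedForm.isAffine TwistedForm.isIso_lift

/-- The twisted form is obtained by descent from `(g, κ) ↦ (α_s⁻¹ g, s κ)` on `G ×_F F̄`, which is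
the standard action for `s` near `1` since `α` is locally constant. -/
lemma exists_twistedForm (a : Cocycle C) : Nonempty (TwistedForm a) := by
  let t (s : AbsGal F) : C.G ⊗ geomPt F ⟶ C.G ⊗ geomPt F :=
    lift ((snd _ _ ≫ a.α s)⁻¹ * fst _ _) (snd _ _ ≫ galPt s)
  have hone : ∀ s, a.α s = 1 → t s ≫ fst _ _ = fst _ _ := fun s hs => by
    simp [t, hs, comp_one]
  obtain ⟨P, hP, π, hπ, hiso⟩ := exists_form (Y := C.G) t
    (by
      apply CartesianMonoidalCategory.hom_ext
      · rw [hone 1 a.α_one, Category.id_comp]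
      · simp [t, galPt_one])
    (fun s s' => by
      apply CartesianMonoidalCategory.hom_ext
      · simp [t, a.cocycle, comp_mul, GrpObj.comp_inv, _root_.mul_assoc, galAct]
      · simp [t, galPt_mul])
    (fun s => lift_snd _ _)
    (by
      have h1 : ∀ᶠ s in 𝓝 (1 : AbsGal F), a.α s = a.α 1 :=
        (IsLocallyConstant.iff_eventually_eq a.α).mp a.isLocallyConstant 1
      filter_upwards [h1] with s hs
      exact hone s (hs.trans a.α_one))
  let e := inv (lift π (snd C.G (geomPt F)))
  have he : e ≫ snd _ _ = snd _ _ := by simp [e]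
  -- the isomorphism `e` from `P ×_F F̄` to `G ×_F F̄` intertwines the two Galois actions
  have het : ∀ s, P ◁ galPt s ≫ e = e ≫ t s := fun s => by
    rw [IsIso.comp_inv_eq, Category.assoc, IsIso.eq_inv_comp]
    apply CartesianMonoidalCategory.hom_ext
    · simp [hπ]
    · simp [t]
  have hlift : lift (e ≫ fst _ _) (snd _ _) = e := by
    apply CartesianMonoidalCategory.hom_ext
    · simp
    · simp [he]
  have : IsIso (lift (e ≫ fst _ _) (snd P (geomPt F))) := by
    rw [hlift]; infer_instance
  refine ⟨⟨P, e ≫ fst _ _, fun s => ?_⟩⟩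
  rw [← Category.assoc, het, Category.assoc, lift_fst, comp_mul, GrpObj.comp_inv, reassoc_of% he]

namespace TwistedForm

variable {a : Cocycle C} (Q : TwistedForm a)

/-- The coordinate in `G(T ×_F F̄)` of a `T`-point of a twisted form of `G`. -/
def coordAt {T : Sch F} (x : T ⟶ Q.P) : T ⊗ geomPt F ⟶ C.G := x ▷ geomPt F ≫ Q.coord

lemma coordAt_comp {S T : Sch F} (t : S ⟶ T) (x : T ⟶ Q.P) :
    Q.coordAt (t ≫ x) = t ▷ geomPt F ≫ Q.coordAt x := by
  rw [coordAt, coordAt, comp_whiskerRight, Category.assoc]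

lemma coordAt_injective {T : Sch F} {x y : T ⟶ Q.P} (h : Q.coordAt x = Q.coordAt y) : x = y := by
  have h1 : x ▷ geomPt F = y ▷ geomPt F := by
    rw [← cancel_mono (lift Q.coord (snd _ _)), comp_lift, comp_lift, whiskerRight_snd,
      whiskerRight_snd]
    exact congrArg (lift · _) h
  rw [← cancel_epi (fst T (geomPt F)), ← whiskerRight_fst, h1, whiskerRight_fst]

lemma galPt_coordAt {T : Sch F} (x : T ⟶ Q.P) (s : AbsGal F) :
    T ◁ galPt s ≫ Q.coordAt x = (snd _ _ ≫ a.α s)⁻¹ * Q.coordAt x := by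
  rw [coordAt, whisker_exchange_assoc, Q.galPt_coord, comp_mul, GrpObj.comp_inv,
    whiskerRight_snd_assoc]

/-- Galois descent for points: a function `g` on `T ×_F F̄` which transforms like a coordinate is
one. -/
lemma exists_coordAt_eq {T : Sch F} [CompactSpace T.left] [QuasiSeparatedSpace T.left]
    (g : T ⊗ geomPt F ⟶ C.G) (hg : ∀ s, T ◁ galPt s ≫ g = (snd _ _ ≫ a.α s)⁻¹ * g) :
    ∃ x, Q.coordAt x = g := by
  let e := inv (lift Q.coord (snd _ _))
  have he : e ≫ snd _ _ = snd _ _ := by simp [e]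
  have he' : e ≫ Q.coord = fst _ _ := by simp [e]
  -- the isomorphism `e` from `G ×_F F̄` to `P ×_F F̄` intertwines the two Galois actions
  have heq : ∀ s, lift ((snd _ _ ≫ a.α s)⁻¹ * fst _ _) (snd _ _ ≫ galPt s) ≫ e =
      e ≫ Q.P ◁ galPt s := fun s => by
    rw [IsIso.comp_inv_eq, Category.assoc, IsIso.eq_inv_comp]
    apply CartesianMonoidalCategory.hom_ext
    · simp [Q.galPt_coord, comp_mul, GrpObj.comp_inv]
    · simp
  obtain ⟨x, hx⟩ := exists_fst_comp_eq (lift g (snd _ _) ≫ e ≫ fst _ _) fun s => by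
    rw [comp_lift_assoc, hg, whiskerLeft_snd]
    have h1 : lift ((snd T (geomPt F) ≫ a.α s)⁻¹ * g) (snd _ _ ≫ galPt s) =
        lift g (snd _ _) ≫ lift ((snd _ _ ≫ a.α s)⁻¹ * fst _ _) (snd _ _ ≫ galPt s) := by
      simp [comp_mul, GrpObj.comp_inv]
    rw [h1, Category.assoc, reassoc_of% heq s, whiskerLeft_fst]
  have h2 : x ▷ geomPt F = lift g (snd _ _) ≫ e := by
    apply CartesianMonoidalCategory.hom_ext
    · rw [whiskerRight_fst, hx, Category.assoc]
    · simp [he]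
  exact ⟨x, by rw [coordAt, h2, Category.assoc, he', lift_fst]⟩

/-- The points of a twisted form over `F̄` are those of `G`. -/
lemma exists_point (g : geomPt F ⟶ C.G) : ∃ p : geomPt F ⟶ Q.P, lift p (𝟙 _) ≫ Q.coord = g := by
  let e := inv (lift Q.coord (snd _ _))
  have he : e ≫ snd _ _ = snd _ _ := by simp [e]
  have he' : e ≫ Q.coord = fst _ _ := by simp [e]
  refine ⟨lift g (𝟙 _) ≫ e ≫ fst _ _, ?_⟩
  have h : lift (lift g (𝟙 _) ≫ e ≫ fst _ _) (𝟙 (geomPt F)) = lift g (𝟙 _) ≫ e := by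
    apply CartesianMonoidalCategory.hom_ext <;> simp [he]
  rw [h, Category.assoc, he', lift_fst]

lemma point_ext {p q : geomPt F ⟶ Q.P}
    (h : lift p (𝟙 _) ≫ Q.coord = lift q (𝟙 _) ≫ Q.coord) : p = q := by
  have h1 : lift p (𝟙 (geomPt F)) = lift q (𝟙 _) := by
    rw [← cancel_mono (lift Q.coord (snd _ _)), comp_lift, comp_lift, lift_snd, lift_snd, h]
  simpa using congrArg (· ≫ fst _ _) h1

/-- Being of finite type descends along `F̄/F`. -/
lemma locallyOfFiniteType : LocallyOfFiniteType Q.P.hom := by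
  have h1 : LocallyOfFiniteType (snd Q.P (geomPt F)).left := by
    have h2 : snd Q.P (geomPt F) = lift Q.coord (snd _ _) ≫ snd _ _ := by simp
    let i : (Q.P ⊗ geomPt F).left ≅ (C.G ⊗ geomPt F).left :=
      (Over.forget _).mapIso (asIso (lift Q.coord (snd _ _)))
    have h3 : (snd Q.P (geomPt F)).left = i.hom ≫ (snd C.G (geomPt F)).left :=
      congrArg CommaMorphism.left h2
    rw [h3]
    have : LocallyOfFiniteType (snd C.G (geomPt F)).left := by dsimp; infer_instance
    infer_instance
  exact MorphismProperty.of_isPullback_of_descendsAlong (P := @LocallyOfFiniteType)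
    (Q := (@Surjective ⊓ @Flat ⊓ @QuasiCompact : MorphismProperty Scheme.{u}))
    (isPullback_fst_snd Q.P (geomPt F)).flip
    ⟨⟨inferInstance, inferInstance⟩, inferInstance⟩ h1

/-- Right translation on a twisted form of `G`. -/
lemma exists_act : ∃ act : Q.P ⊗ C.G ⟶ Q.P, ∀ {T : Sch F} (p : T ⟶ Q.P) (g : T ⟶ C.G),
    Q.coordAt (lift p g ≫ act) = Q.coordAt p * (fst _ _ ≫ g) := by
  obtain ⟨act, hact⟩ := Q.exists_coordAt_eq (Q.coordAt (fst Q.P C.G) * (fst _ _ ≫ snd _ _))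
    fun s => by rw [comp_mul, galPt_coordAt, whiskerLeft_fst_assoc, _root_.mul_assoc]
  refine ⟨act, fun p g => ?_⟩
  rw [coordAt_comp, hact, comp_mul, ← coordAt_comp, lift_fst, whiskerRight_fst_assoc, lift_snd]

/-- The difference of two points of a twisted form of `G`. -/
lemma exists_div : ∃ d : Q.P ⊗ Q.P ⟶ C.G, ∀ {T : Sch F} (p q : T ⟶ Q.P),
    fst T (geomPt F) ≫ lift p q ≫ d = (Q.coordAt p)⁻¹ * Q.coordAt q := by
  obtain ⟨d, hd⟩ := exists_fst_comp_eq ((Q.coordAt (fst Q.P Q.P))⁻¹ * Q.coordAt (snd _ _))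
    fun s => by
      rw [comp_mul, GrpObj.comp_inv, galPt_coordAt, galPt_coordAt, mul_inv_rev, inv_inv,
        _root_.mul_assoc, mul_inv_cancel_left]
  refine ⟨d, fun p q => ?_⟩
  rw [← whiskerRight_fst_assoc, hd, comp_mul, GrpObj.comp_inv, ← coordAt_comp, ← coordAt_comp,
    lift_fst, lift_snd]

/-- The map `g ↦ h⁻¹ ∂(g)` descends to a twisted form of `G`. -/
lemma exists_toH : ∃ f : Q.P ⟶ C.H, ∀ {T : Sch F} (p : T ⟶ Q.P),
    fst T (geomPt F) ≫ p ≫ f = (snd _ _ ≫ a.h)⁻¹ * (Q.coordAt p ≫ C.bd) := by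
  obtain ⟨f, hf⟩ := exists_fst_comp_eq ((snd Q.P _ ≫ a.h)⁻¹ * (Q.coordAt (𝟙 Q.P) ≫ C.bd))
    fun s => by
      rw [comp_mul, GrpObj.comp_inv, ← Category.assoc _ _ C.bd, galPt_coordAt,
        whiskerLeft_snd_assoc]
      conv_rhs => rw [← a.bd_mul s]
      simp only [mul_comp, comp_mul, GrpObj.inv_comp, mul_inv_rev, Category.assoc, galAct,
        _root_.mul_assoc]
  refine ⟨f, fun p => ?_⟩
  rw [← whiskerRight_fst_assoc, hf, comp_mul, GrpObj.comp_inv, whiskerRight_snd_assoc,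
    ← Category.assoc _ _ C.bd, ← coordAt_comp, Category.comp_id]

end TwistedForm

/-- Every cocycle is the cocycle of a bitorsor at a point over `F̄`. -/
theorem exists_bitorsor (a : Cocycle C) : ∃ (X : Bitorsor C) (p : geomPt F ⟶ X.P),
    IsCocycleAt X p a := by
  obtain ⟨Q⟩ := exists_twistedForm a
  obtain ⟨act, hact⟩ := Q.exists_act
  obtain ⟨d, hd⟩ := Q.exists_div
  obtain ⟨f, hf⟩ := Q.exists_toH
  obtain ⟨p, hp⟩ := Q.exists_point 1
  have hval : ∀ x : geomPt F ⟶ Q.P, lift (𝟙 _) (𝟙 _) ≫ Q.coordAt x = lift x (𝟙 _) ≫ Q.coord :=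
    fun x => by
      rw [TwistedForm.coordAt, lift_whiskerRight_assoc, Category.id_comp]
  let X : Bitorsor C :=
    { P := Q.P
      nonempty := ⟨p.left (default : Spec (.of (SeparableClosure F)))⟩
      locallyOfFiniteType := Q.locallyOfFiniteType
      quasiCompact := inferInstance
      isSeparated := inferInstance
      act := act
      act_one := fun q => Q.coordAt_injective (by rw [hact, comp_one, _root_.mul_one])
      act_mul := fun q g g' => Q.coordAt_injective (by
        rw [hact, hact, hact, comp_mul, _root_.mul_assoc])
      simply_transitive := fun {T} x y => by
        refine ⟨lift x y ≫ d, Q.coordAt_injective ?_, fun g hg => ?_⟩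
        · rw [hact, hd, mul_inv_cancel_left]
        · rw [← cancel_epi (fst T (geomPt F)), hd, ← hg, hact, inv_mul_cancel_left]
      f := f
      f_act := fun {T} x g => by
        rw [← cancel_epi (fst T (geomPt F)), hf, hact, mul_comp, comp_mul, hf,
          Category.assoc, _root_.mul_assoc] }
  refine ⟨X, p, ?_, fun s => Q.point_ext ?_⟩
  · have h := congrArg (lift (𝟙 _) (𝟙 _) ≫ ·) (hf p)
    simp only [comp_mul, GrpObj.comp_inv, lift_fst_assoc, lift_snd_assoc, Category.id_comp] at h
    rw [← Category.assoc _ _ C.bd, hval, hp, one_comp, _root_.mul_one] at h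
    exact inv_eq_iff_eq_inv.mp h.symm
  · have h1 : lift (lift p (a.α s) ≫ act) (𝟙 _) ≫ Q.coord = a.α s := by
      rw [← hval, hact, comp_mul, hval, hp, _root_.one_mul, lift_fst_assoc, Category.id_comp]
    have h2 : lift (galAct s p) (𝟙 _) ≫ Q.P ◁ galPt s ≫ Q.coord = 1 := by
      rw [lift_whiskerLeft_assoc, Category.id_comp]
      have : lift (galAct s p) (galPt s) = galPt s ≫ lift p (𝟙 _) := by
        rw [comp_lift, Category.comp_id]; rfl
      rw [this, Category.assoc, hp, comp_one]
    rw [Q.galPt_coord, comp_mul, GrpObj.comp_inv, lift_snd_assoc, Category.id_comp,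
      inv_mul_eq_one] at h2
    exact h1.trans h2

end Twist

/-! ### The bijection between classes of cocycles and of bitorsors -/

section Classes

variable {F : Type u} [Field F] {C C' : CrossedModule F}

/-- The identity morphism of a crossed module. -/
def CrossedModule.Hom.id (C : CrossedModule F) : C.Hom C where
  homG := 𝟙 _
  homH := 𝟙 _
  comm := by simp
  act_comm := by simp

lemma Cocycle.map_id (a : Cocycle C) : a.map (.id C) = a := by
  simp [Cocycle.map, CrossedModule.Hom.id]

/-- A morphism of bitorsors, as a morphism equivariant for the identity. -/
def Bitorsor.Hom.toEquivariantHom {X Y : Bitorsor C} (u : X ⟶ Y) :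
    EquivariantHom (.id C) X Y where
  hom := Bitorsor.Hom.hom u
  equivariant p g := by
    rw [Bitorsor.Hom.equivariant u, CrossedModule.Hom.id, Category.comp_id]
  comp_f := by
    rw [Bitorsor.Hom.comp_f u, CrossedModule.Hom.id, Category.comp_id]

/-- An endomorphism of a bitorsor is determined by its value at a point over `F̄`. -/
lemma Bitorsor.hom_eq_id {X : Bitorsor C} (u : X ⟶ X) {p : geomPt F ⟶ X.P}
    (hp : p ≫ Bitorsor.Hom.hom u = p) : u = 𝟙 X := by
  apply Bitorsor.Hom.ext
  change Bitorsor.Hom.hom u = 𝟙 X.P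
  rw [← cancel_epi (fst X.P (geomPt F)), Category.comp_id]
  have h := Bitorsor.Hom.equivariant u (snd X.P (geomPt F) ≫ p)
    (X.div (snd X.P (geomPt F) ≫ p) (fst _ _))
  rw [Category.assoc (snd _ _) p, hp, X.lift_div] at h
  exact h

lemma IsCocycleAt.exists_hom {X Y : Bitorsor C} {p : geomPt F ⟶ X.P} {q : geomPt F ⟶ Y.P}
    {a : Cocycle C} (ha : IsCocycleAt X p a) (hb : IsCocycleAt Y q a) :
    ∃ u : X ⟶ Y, p ≫ Bitorsor.Hom.hom u = q := by
  rw [← a.map_id] at hb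
  obtain ⟨u, hu⟩ := ha.exists_equivariantHom hb
  refine ⟨⟨u.hom, fun x g => ?_, ?_⟩, hu⟩
  · exact (u.equivariant x g).trans
      (congrArg (lift (x ≫ u.hom) · ≫ Y.act) (Category.comp_id g))
  · exact u.comp_f.trans (Category.comp_id _)

lemma IsCocycleAt.cls_eq {X Y : Bitorsor C} {p : geomPt F ⟶ X.P} {q : geomPt F ⟶ Y.P}
    {a : Cocycle C} (ha : IsCocycleAt X p a) (hb : IsCocycleAt Y q a) : X.cls = Y.cls := by
  obtain ⟨u, hu⟩ := ha.exists_hom hb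
  obtain ⟨v, hv⟩ := hb.exists_hom ha
  refine Quotient.sound (s := isIsomorphicSetoid (Bitorsor C)) ⟨⟨u, v, ?_, ?_⟩⟩
  · refine Bitorsor.hom_eq_id (p := p) _ ?_
    change p ≫ Bitorsor.Hom.hom u ≫ Bitorsor.Hom.hom v = p
    rw [reassoc_of% hu, hv]
  · refine Bitorsor.hom_eq_id (p := q) _ ?_
    change q ≫ Bitorsor.Hom.hom v ≫ Bitorsor.Hom.hom u = q
    rw [reassoc_of% hv, hu]

/-- The class of a `0`-cocycle in `ℍ⁰(F, C)`. -/
def Cocycle.cls (a : Cocycle C) : H0 C := Quotient.mk (cocycleSetoid C) a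

/-- Isomorphic bitorsors have cohomologous cocycles, at any points. -/
lemma IsCocycleAt.cohomology_eq {X Y : Bitorsor C} {p : geomPt F ⟶ X.P}
    {q : geomPt F ⟶ Y.P} {a b : Cocycle C} (ha : IsCocycleAt X p a) (hb : IsCocycleAt Y q b)
    (hXY : X.cls = Y.cls) : a.cls = b.cls := by
  obtain ⟨i⟩ := Quotient.exact (s := isIsomorphicSetoid (Bitorsor C)) hXY
  have h := ha.map (Bitorsor.Hom.toEquivariantHom i.hom)
  rw [a.map_id] at h
  exact Quotient.sound (s := cocycleSetoid C) (h.cohomologous hb)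

lemma exists_bitorsor_of_cls (x : H0 C) : ∃ (X : Bitorsor C) (p : geomPt F ⟶ X.P) (a : Cocycle C),
    a.cls = x ∧ IsCocycleAt X p a := by
  obtain ⟨a, rfl⟩ := Quotient.exists_rep (s := cocycleSetoid C) x
  obtain ⟨X, p, h⟩ := exists_bitorsor a
  exact ⟨X, p, a, rfl, h⟩

/-- The class of the bitorsors with a given class of cocycles. -/
def H0.toBit (x : H0 C) : Bit C := (exists_bitorsor_of_cls x).choose.cls

lemma IsCocycleAt.toBit_eq {X : Bitorsor C} {p : geomPt F ⟶ X.P} {a : Cocycle C}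
    (ha : IsCocycleAt X p a) : a.cls.toBit = X.cls := by
  obtain ⟨q, b, hb, h⟩ := (exists_bitorsor_of_cls a.cls).choose_spec
  obtain ⟨q', h'⟩ := h.of_cohomologous (Quotient.exact (s := cocycleSetoid C) hb)
  exact h'.cls_eq ha

lemma H0.toBit_bijective : Function.Bijective (H0.toBit (C := C)) := by
  refine ⟨fun x y hxy => ?_, fun y => ?_⟩
  · obtain ⟨X, p, a, rfl, ha⟩ := exists_bitorsor_of_cls x
    obtain ⟨Y, q, b, rfl, hb⟩ := exists_bitorsor_of_cls y
    rw [ha.toBit_eq, hb.toBit_eq] at hxy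
    exact ha.cohomology_eq hb hxy
  · obtain ⟨X, rfl⟩ := Quotient.exists_rep (s := isIsomorphicSetoid (Bitorsor C)) y
    obtain ⟨p⟩ := X.exists_point
    obtain ⟨a, ha⟩ := exists_isCocycleAt p
    exact ⟨a.cls, ha.toBit_eq⟩

lemma isPushforward_toBit_iff (φ : C.Hom C') (x : H0 C) (y : Bit C') :
    IsPushforward φ x.toBit y ↔ y = (x.map φ).toBit := by
  obtain ⟨X₀, p₀, a, rfl, ha₀⟩ := exists_bitorsor_of_cls x
  have hmap : a.cls.map φ = (a.map φ).cls := rfl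
  rw [hmap]
  constructor
  · rintro ⟨X, Y, hX, rfl, ⟨u⟩⟩
    obtain ⟨p⟩ := X.exists_point
    obtain ⟨b, hb⟩ := exists_isCocycleAt p
    have hab : b.cls = a.cls := H0.toBit_bijective.1 (hb.toBit_eq.trans hX)
    rw [← hmap, ← hab]
    exact (hb.map u).toBit_eq.symm
  · rintro rfl
    obtain ⟨Y, q, hb⟩ := exists_bitorsor (a.map φ)
    obtain ⟨u, -⟩ := ha₀.exists_equivariantHom hb
    exact ⟨X₀, Y, ha₀.toBit_eq.symm, hb.toBit_eq.symm, ⟨u⟩⟩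

/-- The cocycle of the base change of a bitorsor is the restriction of its cocycle. -/
lemma IsCocycleAt.res {E : Type u} [Field E] [Algebra F E]
    (j : SeparableClosure F →ₐ[F] SeparableClosure E) {X : Bitorsor C} {p : geomPt F ⟶ X.P}
    {a : Cocycle C} (ha : IsCocycleAt X p a) :
    IsCocycleAt (X.baseChange E) (resPt j p) (a.res j) := by
  refine ⟨?_, fun s => ?_⟩
  · change resPt j a.h = (resPt j p ≫ (bc F E).map X.f)⁻¹
    rw [resPt_comp, ha.h_eq, resPt_inv]
  · refine (pull_lift_comp (ptMap j ≫ p) (ptMap j ≫ a.α (resGal j s)) X.act).trans ?_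
    rw [galAct_resPt, ← ha.act_α, resPt, comp_lift_assoc]

lemma baseChange_toBit {E : Type u} [Field E] [Algebra F E]
    (j : SeparableClosure F →ₐ[F] SeparableClosure E) (x : H0 C) :
    x.toBit.baseChange E = (x.res j).toBit := by
  obtain ⟨X, p, a, rfl, ha⟩ := exists_bitorsor_of_cls x
  have hres : a.cls.res j = (a.res j).cls := rfl
  rw [hres, (ha.res j).toBit_eq, ha.toBit_eq]
  rfl

end Classes

end

end CrossedBitorsor

theorem mainTheorem11 :
    ∃ Φ : ∀ (F : Type u) [Field F] (C : CrossedBitorsor.CrossedModule F),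
        CrossedBitorsor.H0 C ≃ CrossedBitorsor.Bit C,
      (∀ (F : Type u) [Field F] (C C' : CrossedBitorsor.CrossedModule F) (φ : C.Hom C')
        (x : CrossedBitorsor.H0 C) (y : CrossedBitorsor.Bit C'),
          CrossedBitorsor.IsPushforward φ (Φ F C x) y ↔ y = Φ F C' (x.map φ)) ∧
      (∀ (F E : Type u) [Field F] [Field E] [Algebra F E]
        (j : SeparableClosure F →ₐ[F] SeparableClosure E)
        (C : CrossedBitorsor.CrossedModule F) (x : CrossedBitorsor.H0 C),
          (Φ F C x).baseChange E = Φ E (C.baseChange E) (x.res j)) :=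
  ⟨fun _ _ _ => Equiv.ofBijective _ CrossedBitorsor.H0.toBit_bijective,
    fun _ _ _ _ φ x y => CrossedBitorsor.isPushforward_toBit_iff φ x y,
    fun _ _ _ _ _ j _ x => CrossedBitorsor.baseChange_toBit j x⟩
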